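/- For a closed set $K\subseteq\mathbf R^2$ let $\delta_K(x)=\inf\{|x-a|:a\in K\}$ be the distance function, $S(K,r)=\{x:\delta_K(x)=r\}$ for $r>0$, $\xi_K(x)=\{a\in K:|x-a|=\delta_K(x)\}$ the (multivalued) nearest point projection, $N(K)=\{(a,u):a\in K,\ |u|=1,\ \delta_K(a+su)=s\text{ for some }s>0\}\subseteq\mathbf R^2\times\mathbf R^2$ the unit normal bundle, and $N(K)|S=\{(a,u)\in N(K):a\in S\}$. Let $\Sigma_2(K)$ be the set of $x\in\mathbf R^2\setminus K$ at which $\delta_K$ is not pointwise twice differentiable, i.e. for which there is no polynomial $P$ of degree at most $2$ with $P(x)=\delta_K(x)$ and $\lim_{y\to x}|\delta_K(y)-P(y)|/|y-x|^2=0$. A multivalued map $T$ is differentiable at $x$ if $T(x)=\{p\}$ is a singleton and there is a linear map $L$ such that for every $\varepsilon>0$ there is $\delta>0$ with $|q-p-L(y-x)|\le\varepsilon|y-x|$ whenever $|y-x|\le\delta$ and $q\in T(y)$; it is directionally differentiable at $x$ if $T(x)=\{p\}$ is a singleton and for every $v$ there is $w$ such that for every $\varepsilon>0$ there is $\delta>0$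 with $|q-p-tw|\le\varepsilon t$ whenever $0<t\le\delta$ and $q\in T(x+tv)$. The restriction $T|A$ equals $T$ on $A$ and is empty-valued off $A$. For each $s\ge0$, $\mathscr H^s$ is the $s$-dimensional Hausdorff measure. **Theorem.** There exist a closed convex set $K\subseteq\mathbf R^2$ with $\mathcal C^{1,1}$ boundary and a dense subset $S$ of $\partial K$ such that 1. $\mathscr H^1(S)=0$ and $\mathscr H^s(S)=+\infty$ for all $0\le s<1$; 2. $\mathscr H^1(N(K)|S)=0$ and $\mathscr H^s(N(K)|S)=+\infty$ for all $0\le s<1$; 3. for all $r>0$ and $(a,u)\in N(K)|S$, the map $\xi_K|S(K,r)$ is not differentiable at $a+ru$; 4. both $\Sigma_2(K)$ and the set of points of $\mathbf R^2\setminus K$ at which $\xi_K$ is not directionally differentiable are dense in $\mathbf R^2\setminus K$ and have Hausdorff dimension $2$. Here $K$ has $\mathcal C^{1,1}$ boundary if near each point of $\partial K$, in suitable orthonormal coordinates, $K$ is the epigraph $\{(x,y):g(x)\le y\}$ of a differentiable function $g:\mathbf R\to\mathbf R$ with Lipschitz derivative. -/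

import Mathlib

open Set Filter Topology MeasureTheory Metric Asymptotics

/-- The Euclidean plane. -/
abbrev Plane : Type := EuclideanSpace ℝ (Fin 2)

/-- `g : ℝ → ℝ` is of class `C^{1,1}`: differentiable, with Lipschitz derivative. -/
def IsC11 (g : ℝ → ℝ) : Prop :=
  Differentiable ℝ g ∧ ∃ L : NNReal, LipschitzWith L (deriv g)

/-- `K ⊆ ℝ²` has `C^{1,1}` boundary: near every boundary point, in suitable orthonormal
coordinates, `K` is the epigraph of a `C^{1,1}` function. -/
def HasC11Boundary (K : Set Plane) : Prop :=
  ∀ p ∈ frontier K, ∃ (T : Plane ≃ₗᵢ[ℝ] Plane) (g : ℝ → ℝ), IsC11 g ∧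
    ∀ᶠ x in 𝓝 p, (x ∈ K ↔ g (T x 0) ≤ T x 1)

section General

variable {E F : Type*} [NormedAddCommGroup E] [NormedSpace ℝ E]
  [NormedAddCommGroup F] [NormedSpace ℝ F]

/-- The multivalued nearest point projection `ξ_K` onto `K`. -/
def nearestPoints (K : Set E) (x : E) : Set E :=
  {a | a ∈ K ∧ ‖x - a‖ = infDist x K}

/-- The level set `S(K, r)` of the distance function `δ_K`. -/
def distLevel (K : Set E) (r : ℝ) : Set E := {x | infDist x K = r}

/-- The restriction `T|A` of a multivalued map: it is empty-valued off `A`. -/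
def multiRestrict (T : E → Set F) (A : Set E) (x : E) : Set F := {y | x ∈ A ∧ y ∈ T x}

/-- Differentiability of a multivalued map at `a`. -/
def MultiDifferentiableAt (T : E → Set F) (a : E) : Prop :=
  ∃ p : F, T a = {p} ∧ ∃ L : E →L[ℝ] F, ∀ ε > 0, ∃ δ > 0, ∀ x, ‖x - a‖ ≤ δ →
    ∀ y ∈ T x, ‖y - p - L (x - a)‖ ≤ ε * ‖x - a‖

/-- Directional differentiability of a multivalued map at `a`: `T a` is a singleton and the
one-sided directional derivative exists in every direction `v`. -/
def MultiDirDifferentiableAt (T : E → Set F) (a : E) : Prop :=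
  ∃ p : F, T a = {p} ∧ ∀ v : E, ∃ w : F, ∀ ε > 0, ∃ δ > 0, ∀ t : ℝ, 0 < t → t ≤ δ →
    ∀ y ∈ T (a + t • v), ‖y - p - t • w‖ ≤ ε * t

/-- Pointwise differentiability of order `2` at `x`: there is a polynomial of degree at most `2`
which takes the value `f x` at `x` and approximates `f` up to `o(‖y - x‖ ^ 2)`. -/
def PointwiseTwiceDifferentiableAt (f : E → ℝ) (x : E) : Prop :=
  ∃ (L : E →L[ℝ] ℝ) (B : E →L[ℝ] E →L[ℝ] ℝ),
    (fun y => f y - (f x + L (y - x) + B (y - x) (y - x))) =o[𝓝 x] fun y => ‖y - x‖ ^ 2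

/-- `Σ₂(K)`: the points off `K` where `δ_K` is not pointwise twice differentiable. -/
def Sigma2 (K : Set E) : Set E :=
  {x | x ∉ K ∧ ¬ PointwiseTwiceDifferentiableAt (fun y => infDist y K) x}

/-- The points off `K` where `ξ_K` is not directionally differentiable. -/
def nonDirDiffPoints (K : Set E) : Set E :=
  {x | x ∉ K ∧ ¬ MultiDirDifferentiableAt (nearestPoints K) x}

/-- The unit normal bundle `N(K)`, with the Euclidean (`ℓ²`) product metric on the ambient
product. -/
def unitNormalBundle (K : Set E) : Set (WithLp 2 (E × E)) :=
  {z | z.fst ∈ K ∧ ‖z.snd‖ = 1 ∧ ∃ s : ℝ, 0 < s ∧ infDist (z.fst + s • z.snd) K = s}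

/-- The part `N(K)|S` of the unit normal bundle over base points in `S`. -/
def unitNormalBundleOver (K S : Set E) : Set (WithLp 2 (E × E)) :=
  {z | z ∈ unitNormalBundle K ∧ z.fst ∈ S}

end General

/-! Take for K the epigraph of g, where g' = F is monotone and Lipschitz, so that K is convex with
C^{1,1} boundary. The point is to make F fail to have a right derivative on a dense set T of
Hausdorff dimension 1; T is null automatically, by Rademacher's theorem. S is the part of the graph
over T.

Construction of F: if a set C has gaps at all scales to the right of its points, a primitive of 1/2
+ sin(log dist(t, C))/2 has mean slopes near 1/4 and near 3/4 on comparable intervals inside those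
gaps, so it has no right derivative at points of C. F is the sum of such primitives with weights
4^{-k}, over rational translates C_k of Cantor sets of dimension log m / log (m + 1). At x the first
C_i containing x decides: earlier terms are differentiable at x, and the later ones together have
slope at most a third of the weight of the i-th, too little to hide an oscillation of half that
weight (`not_differentiableWithinAt_oscSum`).

Geometry: a point off K lies on exactly one normal half-line of the graph. If ξ_K were directionally
differentiable at a point of the normal line over x, moving that point parallel to the tangent would
express the increments of the slope linearly and produce a right derivative of F at x
(`not_multiDirDifferentiableAt_nearestPoints`). The same scheme on the level sets of the distance
gives `not_multiDifferentiableAt_distLevel`. Since y - ξ_K(y) is a subgradient of δ_K²/2, second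
order expansions of δ_K force directional differentiability of ξ_K, so every bad point of ξ_K lies
in Σ₂(K).

Dimension: digits reread in base m map the Cantor set onto [0, 1] by a Hölder map of exponent e near
1. Paired with the distance to K, this maps the bad normal half-lines onto a set of dimension 2,
whence dimension at least 2e. -/

/-! ### Cantor sets omitting one digit: porosity and Hölder maps onto [0, 1] -/

/-- The real number whose base `m + 1` digits are the `d k`, none of which is the last digit. -/
noncomputable def sparseValue {m : ℕ} (d : ℕ → Fin m) : ℝ :=
  Real.ofDigits fun k => (d k).castSucc

/-- The Cantor set of the reals in `[0, 1]` with base `m + 1` digits in `{0, …, m - 1}`. -/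
def sparseSet (m : ℕ) : Set ℝ := range (sparseValue (m := m))

/-- `C` has, to the right of each of its points and at arbitrarily small scales, gaps of a length
comparable to their distance. -/
def RightPorous (C : Set ℝ) : Prop :=
  ∃ M > 0, ∀ x ∈ C, ∀ δ > 0, ∃ a ∈ C, ∃ h > 0, x ≤ a ∧ a + h ≤ x + δ ∧ a - x ≤ M * h ∧
    ∀ y ∈ C, y ≤ a ∨ a + 2 * h ≤ y

lemma isClosed_sparseSet (m : ℕ) : IsClosed (sparseSet m) := by
  refine (isCompact_range ?_).isClosed
  refine Real.continuous_ofDigits.comp ?_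
  exact continuous_pi fun k => continuous_of_discreteTopology.comp (continuous_apply k)

lemma sparseValue_mono {m : ℕ} {d e : ℕ → Fin m} (h : ∀ k, d k ≤ e k) :
    sparseValue d ≤ sparseValue e := by
  refine Summable.tsum_le_tsum (fun k => ?_) Real.summable_ofDigitsTerm Real.summable_ofDigitsTerm
  have : ((d k : ℕ) : ℝ) ≤ (e k : ℕ) := by exact_mod_cast h k
  simp only [Real.ofDigitsTerm, Fin.val_castSucc]
  gcongr

lemma sparseValue_le {m : ℕ} (d : ℕ → Fin m) : sparseValue d ≤ (m - 1) / m := by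
  have hm : 0 < m := Fin.pos (d 0)
  have hm' : (0 : ℝ) < m := by exact_mod_cast hm
  have hlt : ((m : ℝ) + 1)⁻¹ < 1 := inv_lt_one_of_one_lt₀ (by linarith)
  have hsum : HasSum (fun k : ℕ => ((m : ℝ) - 1) * ((m : ℝ) + 1)⁻¹ * (((m : ℝ) + 1)⁻¹) ^ k)
      (((m : ℝ) - 1) * ((m : ℝ) + 1)⁻¹ * (1 - ((m : ℝ) + 1)⁻¹)⁻¹) :=
    (hasSum_geometric_of_lt_one (by positivity) hlt).mul_left _
  have hval : ((m : ℝ) - 1) * ((m : ℝ) + 1)⁻¹ * (1 - ((m : ℝ) + 1)⁻¹)⁻¹ = (m - 1) / m := by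
    have : (1 - ((m : ℝ) + 1)⁻¹) = m / (m + 1) := by field_simp; ring
    rw [this]; field_simp
  rw [← hval, ← hsum.tsum_eq]
  refine Summable.tsum_le_tsum (fun k => ?_) Real.summable_ofDigitsTerm hsum.summable
  have : ((d k : ℕ) : ℝ) ≤ m - 1 := by
    have h : (d k : ℕ) + 1 ≤ m := (d k).2
    have : ((d k : ℕ) : ℝ) + 1 ≤ m := by exact_mod_cast h
    linarith
  simp only [Real.ofDigitsTerm, Fin.val_castSucc, Nat.cast_add, Nat.cast_one]
  rw [mul_assoc, ← pow_succ', inv_pow]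
  gcongr

/-- Because the digit m is never used, a tail of digits is worth at most (m - 1)/m of one unit in
place n, which leaves 1/m of that unit as a gap. -/
lemma sparseValue_separation {m : ℕ} {d e : ℕ → Fin m} {n : ℕ} (h : ∀ i < n, d i = e i)
    (hn : d n < e n) :
    (((m : ℝ) + 1) ^ (n + 1))⁻¹ / m ≤ sparseValue e - sparseValue d := by
  have hm : 0 < m := Fin.pos (d 0)
  have hm' : (0 : ℝ) < m := by exact_mod_cast hm
  have hd := Real.ofDigits_eq_sum_add_ofDigits (fun k => (d k).castSucc) (n + 1)
  have he := Real.ofDigits_eq_sum_add_ofDigits (fun k => (e k).castSucc) (n + 1)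
  rw [Finset.sum_range_succ] at hd he
  have hsum : ∑ i ∈ Finset.range n, Real.ofDigitsTerm (fun k => (d k).castSucc) i
      = ∑ i ∈ Finset.range n, Real.ofDigitsTerm (fun k => (e k).castSucc) i :=
    Finset.sum_congr rfl fun i hi => by simp [Real.ofDigitsTerm, h i (Finset.mem_range.mp hi)]
  have ht : Real.ofDigits (fun k => (d (k + (n + 1))).castSucc) ≤ ((m : ℝ) - 1) / m :=
    sparseValue_le fun k => d (k + (n + 1))
  have he0 : 0 ≤ Real.ofDigits (fun k => (e (k + (n + 1))).castSucc) := Real.ofDigits_nonneg _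
  have hdn : ((d n : ℕ) : ℝ) + 1 ≤ (e n : ℕ) := by exact_mod_cast hn
  simp only [sparseValue]
  rw [hd, he, hsum]
  simp only [Real.ofDigitsTerm, Fin.val_castSucc, Nat.cast_add, Nat.cast_one]
  set P := (((m : ℝ) + 1) ^ (n + 1))⁻¹ with hP
  have hPpos : 0 < P := by positivity
  have h1 : P * Real.ofDigits (fun k => (d (k + (n + 1))).castSucc) ≤ P * (((m : ℝ) - 1) / m) :=
    mul_le_mul_of_nonneg_left ht hPpos.le
  have h2 := mul_nonneg hPpos.le he0
  have h3 : (((d n : ℕ) : ℝ) + 1) * P ≤ (e n : ℕ) * P := mul_le_mul_of_nonneg_right hdn hPpos.le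
  have h4 : P / m = P - P * (((m : ℝ) - 1) / m) := by field_simp; ring
  rw [h4]
  linarith

lemma sparseValue_injective {m : ℕ} : Function.Injective (sparseValue (m := m)) := by
  classical
  intro d e hde
  by_contra hne
  have hex : ∃ n, d n ≠ e n := Function.ne_iff.1 hne
  have hm : 0 < m := Fin.pos (d 0)
  have hm' : (0 : ℝ) < m := by exact_mod_cast hm
  have hmin : ∀ i < Nat.find hex, d i = e i := fun i hi => not_not.1 (Nat.find_min hex hi)
  have hpos : 0 < (((m : ℝ) + 1) ^ (Nat.find hex + 1))⁻¹ / m := by positivity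
  rcases lt_or_gt_of_ne (Nat.find_spec hex) with h | h
  · have := sparseValue_separation hmin h
    linarith
  · have := sparseValue_separation (fun i hi => (hmin i hi).symm) h
    linarith

lemma rightPorous_sparseSet {m : ℕ} (hm : 0 < m) : RightPorous (sparseSet m) := by
  classical
  have hm' : (0 : ℝ) < m := by exact_mod_cast hm
  refine ⟨2 * m, by positivity, ?_⟩
  rintro _ ⟨d, rfl⟩ δ hδ
  have hlt : ((m : ℝ) + 1)⁻¹ < 1 := inv_lt_one_of_one_lt₀ (by linarith)
  obtain ⟨n, hn⟩ := exists_pow_lt_of_lt_one (half_pos hδ) hlt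
  rw [inv_pow] at hn
  set P := (((m : ℝ) + 1) ^ n)⁻¹ with hP
  have hPpos : 0 < P := by positivity
  let top : Fin m := ⟨m - 1, Nat.sub_lt hm one_pos⟩
  have htop : ∀ i : Fin m, i ≤ top := fun i => by
    rw [Fin.le_def]; exact Nat.le_sub_one_of_lt i.2
  -- The right end of the level-n piece of the Cantor set containing d; a gap of length at least P/m
  -- follows it.
  let a : ℕ → Fin m := fun k => if k < n then d k else top
  have hda : ∀ i < n, d i = a i := fun i hi => by simp [a, hi]
  have hclose : sparseValue a - sparseValue d ≤ P := by
    have := Real.abs_ofDigits_sub_ofDigits_le (x := fun k => (a k).castSucc)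
      (y := fun k => (d k).castSucc) (n := n) (fun i hi => by simp [hda i hi])
    push_cast at this
    exact (le_abs_self _).trans this
  have hPm : P / (2 * m) ≤ P := by
    apply div_le_self hPpos.le
    have : (1 : ℝ) ≤ m := by exact_mod_cast hm
    linarith
  -- h is half of P/m, and the piece has length at most P = 2m · h, which explains the porosity
  -- constant 2m.
  refine ⟨sparseValue a, ⟨a, rfl⟩, P / (2 * m), by positivity, ?_, by linarith, ?_, ?_⟩
  · refine sparseValue_mono fun k => ?_
    by_cases hk : k < n
    · simp [a, hk]
    · simp only [a, hk, if_false]; exact htop _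
  · have : 2 * m * (P / (2 * m)) = P := by field_simp
    rw [this]; exact hclose
  · rintro _ ⟨e, rfl⟩
    by_cases heq : ∀ i < n, e i = d i
    · left
      refine sparseValue_mono fun k => ?_
      by_cases hk : k < n
      · simp [a, hk, heq k hk]
      · simp only [a, hk, if_false]; exact htop _
    · push Not at heq
      have hspec := Nat.find_spec heq
      have hmin : ∀ i < Nat.find heq, e i = a i := fun i hi => by
        have h1 := Nat.find_min heq hi
        push Not at h1
        have h2 := hi.trans hspec.1
        rw [h1 h2, hda i h2]
      have hne : e (Nat.find heq) ≠ a (Nat.find heq) := by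
        rw [← hda _ hspec.1]; exact hspec.2
      rcases lt_or_gt_of_ne hne with h | h
      · left
        have := sparseValue_separation hmin h
        have hpos : 0 < (((m : ℝ) + 1) ^ (Nat.find heq + 1))⁻¹ / m := by positivity
        linarith
      · right
        have h1 := sparseValue_separation (fun i hi => (hmin i hi).symm) h
        have h2 : P / m ≤ (((m : ℝ) + 1) ^ (Nat.find heq + 1))⁻¹ / m := by
          have : Nat.find heq + 1 ≤ n := hspec.1
          rw [hP]
          gcongr
          linarith
        have h3 : 2 * (P / (2 * m)) = P / m := by field_simp
        linarith

lemma RightPorous.translate {C : Set ℝ} (hC : RightPorous C) (q : ℝ) :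
    RightPorous {x | x - q ∈ C} := by
  obtain ⟨M, hM, H⟩ := hC
  refine ⟨M, hM, fun x hx δ hδ => ?_⟩
  obtain ⟨a, ha, h, hh, h1, h2, h3, h4⟩ := H (x - q) hx δ hδ
  refine ⟨a + q, by simpa using ha, h, hh, by linarith, by linarith, by linarith, fun y hy => ?_⟩
  rcases h4 (y - q) hy with h | h
  · left; linarith
  · right; linarith

/-- The exponent `log m / log (m + 1)`, the dimension of `sparseSet m`. -/
noncomputable def sparseExponent (m : ℕ) : NNReal :=
  (Real.log m / Real.log ((m : ℝ) + 1)).toNNReal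

lemma sparseExponent_coe (m : ℕ) :
    (sparseExponent m : ℝ) = Real.log m / Real.log ((m : ℝ) + 1) := by
  refine Real.coe_toNNReal _ (div_nonneg (Real.log_natCast_nonneg m) (Real.log_nonneg ?_))
  have : (0 : ℝ) ≤ m := Nat.cast_nonneg m
  linarith

lemma sparseExponent_le_one (m : ℕ) : sparseExponent m ≤ 1 := by
  rw [← NNReal.coe_le_coe, sparseExponent_coe, NNReal.coe_one]
  rcases Nat.eq_zero_or_pos m with rfl | hm
  · simp
  · have h : (0 : ℝ) < m := by exact_mod_cast hm
    exact div_le_one_of_le₀ (Real.log_le_log h (by linarith)) (Real.log_nonneg (by linarith))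

/-- As log (m + 1) ≤ log m + log 2 and log m → ∞, the exponents tend to 1. -/
lemma exists_sparseExponent_ge {r : ℝ} (hr : r < 1) :
    ∃ m : ℕ, 2 ≤ m ∧ r ≤ sparseExponent m := by
  have hlog : Tendsto (fun m : ℕ => Real.log m) atTop atTop :=
    Real.tendsto_log_atTop.comp tendsto_natCast_atTop_atTop
  obtain ⟨m, hm2, hm⟩ := ((eventually_ge_atTop 2).and
    (hlog.eventually_ge_atTop (Real.log 2 / (1 - r)))).exists
  refine ⟨m, hm2, ?_⟩
  have hmR : (2 : ℝ) ≤ m := by exact_mod_cast hm2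
  rw [sparseExponent_coe, le_div_iff₀ (Real.log_pos (by linarith))]
  rw [div_le_iff₀ (by linarith)] at hm
  have h1 : Real.log ((m : ℝ) + 1) ≤ Real.log m + Real.log 2 := by
    rw [← Real.log_mul (by positivity) (by positivity)]
    exact Real.log_le_log (by positivity) (by linarith)
  have h0 : Real.log m ≤ Real.log ((m : ℝ) + 1) := Real.log_le_log (by linarith) (by linarith)
  have h2 : 0 ≤ Real.log m := Real.log_natCast_nonneg m
  have h3 : 0 ≤ Real.log 2 := Real.log_nonneg (by norm_num)
  rcases le_or_gt 0 r with h | h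
  · nlinarith
  · nlinarith

/-- The map rereads the base m + 1 digits in base m. If digits first differ in place n, the values
in base m differ by at most m^{-n}, while the Cantor points are at least (m + 1)^{-(n + 2)} apart.
The exponent turns the latter into m^{-(n + 2)}, so the constant m² suffices. -/
lemma exists_holderOnWith_sparseSet {m : ℕ} (hm : 2 ≤ m) :
    ∃ (f : ℝ → ℝ) (c : NNReal), HolderOnWith c (sparseExponent m) f (sparseSet m) ∧
      Icc 0 1 ⊆ f '' sparseSet m := by
  classical
  have hm0 : 0 < m := by omega
  have hm1 : (1 : ℝ) < m := by exact_mod_cast hm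
  have : Nonempty (ℕ → Fin m) := ⟨fun _ => ⟨0, hm0⟩⟩
  let inv : ℝ → (ℕ → Fin m) := Function.invFun sparseValue
  have hinv : ∀ d : ℕ → Fin m, inv (sparseValue d) = d :=
    Function.leftInverse_invFun sparseValue_injective
  refine ⟨fun x => Real.ofDigits (inv x), (m : NNReal) ^ 2, ?_, ?_⟩
  · have key : ∀ (d e : ℕ → Fin m) (n : ℕ), (∀ i < n, d i = e i) → d n < e n →
        |Real.ofDigits d - Real.ofDigits e| ≤
          (m : ℝ) ^ 2 * |sparseValue d - sparseValue e| ^ (sparseExponent m : ℝ) := by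
      intro d e n hde hn
      have h1 := Real.abs_ofDigits_sub_ofDigits_le hde
      have h2 := sparseValue_separation hde hn
      have h3 : (((m : ℝ) + 1) ^ (n + 2))⁻¹ ≤ |sparseValue d - sparseValue e| := by
        rw [abs_sub_comm]
        refine le_trans (le_trans ?_ h2) (le_abs_self _)
        rw [div_eq_mul_inv, ← mul_inv, pow_succ _ (n + 1)]
        gcongr
        linarith
      have h4 : ((((m : ℝ) + 1) ^ (n + 2))⁻¹) ^ (sparseExponent m : ℝ) = ((m : ℝ) ^ (n + 2))⁻¹ := by
        have hb : ((m : ℝ) + 1) ^ (sparseExponent m : ℝ) = m := by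
          rw [sparseExponent_coe, Real.rpow_def_of_pos (by linarith),
            mul_div_cancel₀ _ (Real.log_pos (by linarith)).ne', Real.exp_log (by linarith)]
        rw [Real.inv_rpow (by positivity), ← Real.rpow_natCast, ← Real.rpow_mul (by positivity),
          mul_comm, Real.rpow_mul (by positivity), hb, Real.rpow_natCast]
      have h5 := Real.rpow_le_rpow (by positivity) h3 (sparseExponent m).coe_nonneg
      rw [h4] at h5
      calc |Real.ofDigits d - Real.ofDigits e| ≤ ((m : ℝ) ^ n)⁻¹ := h1
        _ = (m : ℝ) ^ 2 * ((m : ℝ) ^ (n + 2))⁻¹ := by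
            have : (m : ℝ) ≠ 0 := by positivity
            field_simp
            ring
        _ ≤ _ := by gcongr
    rintro _ ⟨d, rfl⟩ _ ⟨e, rfl⟩
    simp only [hinv]
    have main : |Real.ofDigits d - Real.ofDigits e| ≤
          (m : ℝ) ^ 2 * |sparseValue d - sparseValue e| ^ (sparseExponent m : ℝ) := by
      by_cases hne : d = e
      · subst hne
        simp only [sub_self, abs_zero]
        positivity
      · have hex : ∃ n, d n ≠ e n := Function.ne_iff.1 hne
        have hmin : ∀ i < Nat.find hex, d i = e i := fun i hi => not_not.1 (Nat.find_min hex hi)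
        rcases lt_or_gt_of_ne (Nat.find_spec hex) with h | h
        · exact key d e _ hmin h
        · rw [abs_sub_comm, abs_sub_comm (sparseValue d)]
          exact key e d _ (fun i hi => (hmin i hi).symm) h
    rw [edist_dist, edist_dist, Real.dist_eq, Real.dist_eq,
      ENNReal.ofReal_rpow_of_nonneg (abs_nonneg _) (sparseExponent m).coe_nonneg,
      ← ENNReal.ofReal_coe_nnreal, ← ENNReal.ofReal_mul (NNReal.coe_nonneg _)]
    exact ENNReal.ofReal_le_ofReal (by simpa using main)
  · intro z hz
    obtain ⟨d, -, hd⟩ := Real.ofDigits_SurjOn (b := m) (by omega) hz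
    exact ⟨sparseValue d, ⟨d, rfl⟩, by simp only [hinv, hd]⟩

/-- The translate `q + sparseSet m`. -/
def translatedSparseSet (q : ℝ) (m : ℕ) : Set ℝ := {x | x - q ∈ sparseSet m}

lemma isClosed_translatedSparseSet (q : ℝ) (m : ℕ) : IsClosed (translatedSparseSet q m) :=
  (isClosed_sparseSet m).preimage (continuous_id.sub continuous_const)

lemma mem_translatedSparseSet_self (q : ℝ) {m : ℕ} (hm : 0 < m) :
    q ∈ translatedSparseSet q m := by
  refine ⟨fun _ => ⟨0, hm⟩, ?_⟩
  simp [sparseValue, Real.ofDigits, Real.ofDigitsTerm]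

lemma exists_holderOnWith_translatedSparseSet (q : ℝ) {m : ℕ} (hm : 2 ≤ m) :
    ∃ (f : ℝ → ℝ) (c : NNReal),
      HolderOnWith c (sparseExponent m) f (translatedSparseSet q m) ∧
      Icc 0 1 ⊆ f '' translatedSparseSet q m := by
  obtain ⟨f, c, hf, hsurj⟩ := exists_holderOnWith_sparseSet hm
  refine ⟨fun x => f (x - q), c, fun x hx y hy => ?_, fun z hz => ?_⟩
  · have := hf _ hx _ hy
    rwa [edist_sub_right] at this
  · obtain ⟨x, hx, rfl⟩ := hsurj hz
    exact ⟨x + q, by simpa [translatedSparseSet] using hx, by simp⟩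

/-! ### A monotone Lipschitz function without right derivatives on a large set -/

/-- A function with values in `[0, 1]` whose mean values on `[0, t]` oscillate as `t → 0`. -/
noncomputable def oscDensity (s : ℝ) : ℝ := 1 / 2 + Real.sin (Real.log s) / 2

lemma oscDensity_nonneg (s : ℝ) : 0 ≤ oscDensity s := by
  have := Real.neg_one_le_sin (Real.log s)
  unfold oscDensity; linarith

lemma oscDensity_le_one (s : ℝ) : oscDensity s ≤ 1 := by
  have := Real.sin_le_one (Real.log s)
  unfold oscDensity; linarith

lemma measurable_oscDensity : Measurable oscDensity := by
  unfold oscDensity; fun_prop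

lemma continuousAt_oscDensity {s : ℝ} (hs : s ≠ 0) : ContinuousAt oscDensity s := by
  unfold oscDensity
  have := Real.continuousAt_log hs
  fun_prop

lemma intervalIntegrable_of_mem_Icc {φ : ℝ → ℝ} (hm : Measurable φ) (h0 : ∀ s, 0 ≤ φ s)
    (h1 : ∀ s, φ s ≤ 1) (a b : ℝ) : IntervalIntegrable φ volume a b := by
  refine (intervalIntegrable_const (c := (1 : ℝ))).mono_fun hm.aestronglyMeasurable ?_
  exact Eventually.of_forall fun s => by
    simpa [abs_of_nonneg (h0 s)] using h1 s

lemma integral_oscDensity {t : ℝ} (ht : 0 ≤ t) :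
    ∫ s in (0 : ℝ)..t, oscDensity s =
      t / 2 + (t * Real.sin (Real.log t) - t * Real.cos (Real.log t)) / 4 := by
  have hcont : ∀ f : ℝ → ℝ, Continuous f → (∀ x, |f x| ≤ 1) →
      Continuous fun s => s * f (Real.log s) := by
    intro f hf hb
    rw [continuous_iff_continuousAt]
    intro s
    rcases eq_or_ne s 0 with rfl | hs
    · have : Tendsto (fun s : ℝ => s * f (Real.log s)) (𝓝 0) (𝓝 0) := by
        refine squeeze_zero_norm (a := fun s : ℝ => |s|) (fun s => ?_) ?_
        · rw [Real.norm_eq_abs, abs_mul]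
          exact mul_le_of_le_one_right (abs_nonneg _) (hb _)
        · simpa using (continuous_abs.tendsto (0 : ℝ))
      simpa [ContinuousAt] using this
    · exact continuousAt_id.mul (hf.continuousAt.comp (Real.continuousAt_log hs))
  have h := intervalIntegral.integral_eq_sub_of_hasDerivAt_of_le (f := fun t =>
      t / 2 + (t * Real.sin (Real.log t) - t * Real.cos (Real.log t)) / 4) (f' := oscDensity) ht
    ?_ ?_ (intervalIntegrable_of_mem_Icc measurable_oscDensity oscDensity_nonneg
      oscDensity_le_one 0 t)
  · rw [h]; simp
  · have h1 := hcont Real.sin Real.continuous_sin Real.abs_sin_le_one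
    have h2 := hcont Real.cos Real.continuous_cos Real.abs_cos_le_one
    exact ((continuous_id.div_const 2).add ((h1.sub h2).div_const 4)).continuousOn
  · intro s hs
    have hs0 : s ≠ 0 := hs.1.ne'
    have hl := Real.hasDerivAt_log hs0
    have hsin := (hasDerivAt_id s).mul hl.sin
    have hcos := (hasDerivAt_id s).mul hl.cos
    refine (((hasDerivAt_id s).div_const 2).add ((hsin.sub hcos).div_const 4)).congr_deriv ?_
    simp only [oscDensity, id]
    field_simp
    ring

/-- The primitive of the oscillating density of the distance to `C`. -/
noncomputable def oscPrimitive (C : Set ℝ) (x : ℝ) : ℝ :=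
  ∫ t in (0 : ℝ)..x, oscDensity (infDist t C)

lemma measurable_oscDensity_infDist (C : Set ℝ) : Measurable fun t => oscDensity (infDist t C) :=
  measurable_oscDensity.comp (continuous_infDist_pt C).measurable

lemma oscPrimitive_sub (C : Set ℝ) (x y : ℝ) :
    oscPrimitive C y - oscPrimitive C x = ∫ t in x..y, oscDensity (infDist t C) := by
  have h := intervalIntegrable_of_mem_Icc (measurable_oscDensity_infDist C)
    (fun _ => oscDensity_nonneg _) (fun _ => oscDensity_le_one _)
  exact intervalIntegral.integral_interval_sub_left (h _ _) (h _ _)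

lemma oscPrimitive_sub_mem {C : Set ℝ} {x y : ℝ} (hxy : x ≤ y) :
    oscPrimitive C y - oscPrimitive C x ∈ Icc 0 (y - x) := by
  have h := intervalIntegrable_of_mem_Icc (measurable_oscDensity_infDist C)
    (fun _ => oscDensity_nonneg _) (fun _ => oscDensity_le_one _)
  rw [oscPrimitive_sub]
  refine ⟨intervalIntegral.integral_nonneg hxy fun _ _ => oscDensity_nonneg _, ?_⟩
  calc _ ≤ ∫ _ in x..y, (1 : ℝ) :=
        intervalIntegral.integral_mono_on hxy (h _ _) intervalIntegrable_const
          fun _ _ => oscDensity_le_one _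
    _ = y - x := by simp

lemma oscPrimitive_zero (C : Set ℝ) : oscPrimitive C 0 = 0 := by simp [oscPrimitive]

lemma abs_oscPrimitive_le (C : Set ℝ) (x : ℝ) : |oscPrimitive C x| ≤ |x| := by
  rcases le_total 0 x with h | h
  · have := oscPrimitive_sub_mem (C := C) h
    rw [oscPrimitive_zero, sub_zero, sub_zero] at this
    rw [abs_of_nonneg this.1, abs_of_nonneg h]; exact this.2
  · have := oscPrimitive_sub_mem (C := C) h
    rw [oscPrimitive_zero, zero_sub, zero_sub] at this
    rw [abs_of_nonpos (by linarith [this.1]), abs_of_nonpos h]; exact this.2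

lemma differentiableAt_oscPrimitive {C : Set ℝ} (hC : IsClosed C) (hne : C.Nonempty) {x : ℝ}
    (hx : x ∉ C) : DifferentiableAt ℝ (oscPrimitive C) x := by
  refine (intervalIntegral.integral_hasDerivAt_right
    (intervalIntegrable_of_mem_Icc (measurable_oscDensity_infDist C)
    (fun _ => oscDensity_nonneg _) (fun _ => oscDensity_le_one _) _ _)
    (measurable_oscDensity_infDist C).stronglyMeasurable.stronglyMeasurableAtFilter
    ?_).differentiableAt
  have hpos : infDist x C ≠ 0 := ((hC.notMem_iff_infDist_pos hne).1 hx).ne'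
  exact ContinuousAt.comp (f := fun t => infDist t C) (continuousAt_oscDensity hpos)
    (continuous_infDist_pt C).continuousAt

/-- In the left half of a gap the nearest point of C is the left end a, so the density there is
exactly `oscDensity` of the distance to a. -/
lemma oscPrimitive_sub_of_gap {C : Set ℝ} {a h t : ℝ} (ha : a ∈ C)
    (hgap : ∀ y ∈ C, y ≤ a ∨ a + 2 * h ≤ y) (ht0 : 0 ≤ t) (ht : t ≤ h) :
    oscPrimitive C (a + t) - oscPrimitive C a =
      t / 2 + (t * Real.sin (Real.log t) - t * Real.cos (Real.log t)) / 4 := by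
  rw [oscPrimitive_sub, ← integral_oscDensity ht0]
  have hsub : ∫ s in (0 : ℝ)..t, oscDensity (infDist (a + s) C) =
      ∫ s in a..(a + t), oscDensity (infDist s C) := by
    rw [intervalIntegral.integral_comp_add_left (fun s => oscDensity (infDist s C)) a, add_zero]
  rw [← hsub]
  refine intervalIntegral.integral_congr fun s hs => ?_
  rw [uIcc_of_le ht0] at hs
  have : infDist (a + s) C = s := by
    refine le_antisymm ?_ ?_
    · refine (infDist_le_dist_of_mem ha).trans ?_
      rw [Real.dist_eq, add_sub_cancel_left, abs_of_nonneg hs.1]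
    · refine (le_infDist ⟨a, ha⟩).2 fun y hy => ?_
      rw [Real.dist_eq]
      have := hs.1
      have := hs.2
      rcases hgap y hy with h1 | h1
      · exact le_trans (by linarith) (le_abs_self _)
      · exact le_trans (by linarith) (neg_le_abs _)
  simp only [this]

/-- The weighted sum of the oscillating primitives of a sequence of sets. -/
noncomputable def oscSum (C : ℕ → Set ℝ) (x : ℝ) : ℝ :=
  ∑' k, (1 / 4 : ℝ) ^ k * oscPrimitive (C k) x

lemma summable_oscSum (C : ℕ → Set ℝ) (x : ℝ) :
    Summable fun k => (1 / 4 : ℝ) ^ k * oscPrimitive (C k) x := by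
  refine Summable.of_norm_bounded (g := fun k => (1 / 4 : ℝ) ^ k * |x|) ?_ fun k => ?_
  · exact (summable_geometric_of_lt_one (by norm_num) (by norm_num)).mul_right _
  · rw [norm_mul, Real.norm_eq_abs, Real.norm_eq_abs, abs_of_nonneg (by positivity)]
    exact mul_le_mul_of_nonneg_left (abs_oscPrimitive_le _ _) (by positivity)

lemma oscSum_sub_mem (C : ℕ → Set ℝ) {x y : ℝ} (hxy : x ≤ y) :
    oscSum C y - oscSum C x ∈ Icc 0 (4 / 3 * (y - x)) := by
  have hs := (summable_oscSum C y).sub (summable_oscSum C x)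
  unfold oscSum
  rw [← Summable.tsum_sub (summable_oscSum C y) (summable_oscSum C x)]
  have hk := fun k => oscPrimitive_sub_mem (C := C k) hxy
  have hg : HasSum (fun k : ℕ => (1 / 4 : ℝ) ^ k * (y - x)) (4 / 3 * (y - x)) := by
    have := (hasSum_geometric_of_lt_one (r := (1 / 4 : ℝ)) (by norm_num) (by norm_num)).mul_right
      (y - x)
    convert! this using 2; norm_num
  refine ⟨tsum_nonneg fun k => ?_, ?_⟩
  · rw [← mul_sub]; exact mul_nonneg (by positivity) (hk k).1
  · rw [← hg.tsum_eq]
    refine Summable.tsum_le_tsum (fun k => ?_) hs hg.summable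
    rw [← mul_sub]; exact mul_le_mul_of_nonneg_left (hk k).2 (by positivity)

lemma oscSum_eq (C : ℕ → Set ℝ) (i : ℕ) (x : ℝ) :
    oscSum C x = (∑ k ∈ Finset.range i, (1 / 4 : ℝ) ^ k * oscPrimitive (C k) x) +
      ((1 / 4 : ℝ) ^ i * oscPrimitive (C i) x +
        (1 / 4 : ℝ) ^ (i + 1) * oscSum (fun k => C (k + (i + 1))) x) := by
  rw [oscSum, ← Summable.sum_add_tsum_nat_add (i + 1) (summable_oscSum C x),
    Finset.sum_range_succ, add_assoc]
  congr 2
  rw [oscSum, ← tsum_mul_left]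
  refine tsum_congr fun k => ?_
  ring

lemma HasDerivWithinAt.abs_sub_sub_le_of_Ioi {H : ℝ → ℝ} {D x : ℝ}
    (h : HasDerivWithinAt H D (Ioi x) x) {ε : ℝ} (hε : 0 < ε) :
    ∃ δ > 0, ∀ y, x ≤ y → y ≤ x + δ → |H y - H x - D * (y - x)| ≤ ε * (y - x) := by
  have h1 := (hasDerivWithinAt_iff_isLittleO.1 h.Ici_of_Ioi).def hε
  rw [eventually_nhdsWithin_iff, Metric.eventually_nhds_iff] at h1
  obtain ⟨δ, hδ, H1⟩ := h1
  refine ⟨δ / 2, by positivity, fun y hy1 hy2 => ?_⟩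
  have := H1 (y := y) (by rw [Real.dist_eq, abs_of_nonneg] <;> linarith) hy1
  rw [Real.norm_eq_abs, Real.norm_eq_abs, abs_of_nonneg (sub_nonneg.2 hy1), smul_eq_mul,
    mul_comm _ D] at this
  exact this

/-- With 2πn the largest such multiple below log h, take t₁ = exp(2πn) and t₂ = exp(2πn - π); both
are within the factor exp(3π) of h. -/
lemma exists_scale {h : ℝ} (hh : 0 < h) :
    ∃ t₁ t₂ : ℝ, 0 < t₁ ∧ t₁ ≤ h ∧ h ≤ Real.exp (3 * Real.pi) * t₁ ∧
      0 < t₂ ∧ t₂ ≤ h ∧ h ≤ Real.exp (3 * Real.pi) * t₂ ∧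
      Real.sin (Real.log t₁) = 0 ∧ Real.cos (Real.log t₁) = 1 ∧
      Real.sin (Real.log t₂) = 0 ∧ Real.cos (Real.log t₂) = -1 := by
  have hpi := Real.pi_pos
  set n : ℤ := ⌊Real.log h / (2 * Real.pi)⌋ with hn
  have h1 : (n : ℝ) * (2 * Real.pi) ≤ Real.log h := by
    rw [← le_div_iff₀ (by positivity)]; exact Int.floor_le _
  have h2 : Real.log h ≤ ((n : ℝ) + 1) * (2 * Real.pi) := by
    rw [← div_le_iff₀ (by positivity)]; exact (Int.lt_floor_add_one _).le
  have hexp : Real.exp (Real.log h) = h := Real.exp_log hh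
  refine ⟨Real.exp (n * (2 * Real.pi)), Real.exp (n * (2 * Real.pi) - Real.pi),
    Real.exp_pos _, ?_, ?_, Real.exp_pos _, ?_, ?_, ?_, ?_, ?_, ?_⟩
  · rw [← hexp]; exact Real.exp_le_exp.2 h1
  · rw [← Real.exp_add]; nth_rw 1 [← hexp]; exact Real.exp_le_exp.2 (by linarith)
  · rw [← hexp]; exact Real.exp_le_exp.2 (by linarith)
  · rw [← Real.exp_add]; nth_rw 1 [← hexp]; exact Real.exp_le_exp.2 (by linarith)
  · rw [Real.log_exp]; simpa using Real.sin_add_int_mul_two_pi 0 n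
  · rw [Real.log_exp]; simp
  · rw [Real.log_exp, Real.sin_sub_pi]; simpa using Real.sin_add_int_mul_two_pi 0 n
  · rw [Real.log_exp, Real.cos_sub_pi]; simp

/-- On [a, a + t₁] and [a, a + t₂] the primitive has mean slopes 1/4 and 3/4. The perturbation R
adds between 0 and w/3, so D would have to be at most about 7w/12 and at least about 3w/4. -/
lemma not_hasDerivWithinAt_of_rightPorous {C : Set ℝ} (hC : RightPorous C) {x : ℝ} (hx : x ∈ C)
    {w : ℝ} (hw : 0 < w) {R : ℝ → ℝ}
    (hR : ∀ p q, p ≤ q → R q - R p ∈ Icc 0 (w / 3 * (q - p))) (D : ℝ) :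
    ¬ HasDerivWithinAt (fun y => w * oscPrimitive C y + R y) D (Ioi x) x := by
  intro hD
  obtain ⟨M, hM, H⟩ := hC
  -- N bounds (a + t - x)/t for both scales: the gap lies at distance at most M h from x and h ≤
  -- exp(3π) t.
  set N : ℝ := (M + 1) * Real.exp (3 * Real.pi) with hN
  have hNpos : 0 < N := by positivity
  obtain ⟨δ, hδ, Hδ⟩ := hD.abs_sub_sub_le_of_Ioi (ε := w / (25 * N)) (by positivity)
  obtain ⟨a, ha, h, hh, h1, h2, h3, h4⟩ := H x hx δ hδ
  obtain ⟨t₁, t₂, p1, l1, m1, p2, l2, m2, s1, c1, s2, c2⟩ := exists_scale hh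
  have key : ∀ t, 0 < t → t ≤ h → h ≤ Real.exp (3 * Real.pi) * t →
      |w * (oscPrimitive C (a + t) - oscPrimitive C a) + (R (a + t) - R a) - D * t|
        ≤ 2 / 25 * w * t := by
    intro t ht0 hth hht
    have e1 := Hδ (a + t) (by linarith) (by linarith)
    have e2 := Hδ a h1 (by linarith)
    have e3 : a + t - x ≤ N * t := by
      have : (M + 1) * h ≤ (M + 1) * (Real.exp (3 * Real.pi) * t) := by gcongr
      rw [hN, mul_assoc]; linarith
    have e4 : w / (25 * N) * (a + t - x) ≤ w / 25 * t := by
      calc w / (25 * N) * (a + t - x) ≤ w / (25 * N) * (N * t) := by gcongr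
        _ = w / 25 * t := by field_simp
    have e5 : w / (25 * N) * (a - x) ≤ w / (25 * N) * (a + t - x) := by gcongr; linarith
    rw [abs_le] at *
    constructor <;> linarith [e1.1, e1.2, e2.1, e2.2]
  have k1 := key t₁ p1 l1 m1
  have k2 := key t₂ p2 l2 m2
  rw [oscPrimitive_sub_of_gap ha h4 p1.le l1, s1, c1] at k1
  rw [oscPrimitive_sub_of_gap ha h4 p2.le l2, s2, c2] at k2
  have r1 := hR a (a + t₁) (by linarith)
  have r2 := hR a (a + t₂) (by linarith)
  rw [add_sub_cancel_left] at r1 r2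
  -- Here 7/12 = 1/4 + 1/3, and the errors 2/25 on both sides still fit: 4/25 < 3/4 - 7/12 = 1/6.
  have d1 : D * t₁ ≤ (w * (7 / 12 + 2 / 25)) * t₁ := by
    have := (abs_le.1 k1).1
    have := r1.2
    linarith
  have d2 : (w * (3 / 4 - 2 / 25)) * t₂ ≤ D * t₂ := by
    have := (abs_le.1 k2).2
    have := r2.1
    linarith
  have d1' := le_of_mul_le_mul_right d1 p1
  have d2' := le_of_mul_le_mul_right d2 p2
  nlinarith

/-- Only the first index i with x ∈ C i matters: x lies off the earlier closed sets, where the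
primitives are differentiable, and the tail has Lipschitz constant (1/4)^{i+1} · 4/3, one third of
the weight (1/4)^i. -/
theorem not_differentiableWithinAt_oscSum {C : ℕ → Set ℝ} (hcl : ∀ i, IsClosed (C i))
    (hne : ∀ i, (C i).Nonempty) (hC : ∀ i, RightPorous (C i)) {x : ℝ} (hx : ∃ i, x ∈ C i) :
    ¬ DifferentiableWithinAt ℝ (oscSum C) (Ioi x) x := by
  classical
  intro hdiff
  set i := Nat.find hx with hi
  have hxi : x ∈ C i := Nat.find_spec hx
  have hG : DifferentiableAt ℝ
      (fun y => ∑ k ∈ Finset.range i, (1 / 4 : ℝ) ^ k * oscPrimitive (C k) y) x := by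
    refine DifferentiableAt.fun_sum fun k hk => ?_
    exact (differentiableAt_oscPrimitive (hcl k) (hne k)
      (Nat.find_min hx (Finset.mem_range.1 hk))).const_mul _
  have hH := hdiff.sub hG.differentiableWithinAt
  have heq : oscSum C - (fun y => ∑ k ∈ Finset.range i, (1 / 4 : ℝ) ^ k * oscPrimitive (C k) y) =
      fun y => (1 / 4 : ℝ) ^ i * oscPrimitive (C i) y +
        (1 / 4 : ℝ) ^ (i + 1) * oscSum (fun k => C (k + (i + 1))) y := by
    funext y
    rw [Pi.sub_apply, oscSum_eq C i y]
    ring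
  rw [heq] at hH
  refine not_hasDerivWithinAt_of_rightPorous (hC i) hxi (w := (1 / 4 : ℝ) ^ i) (by positivity)
    (fun p q hpq => ?_) _ hH.hasDerivWithinAt
  have := oscSum_sub_mem (fun k => C (k + (i + 1))) hpq
  rw [← mul_sub]
  refine ⟨mul_nonneg (by positivity) this.1, ?_⟩
  have h2 := mul_le_mul_of_nonneg_left this.2 (show (0 : ℝ) ≤ (1 / 4 : ℝ) ^ (i + 1) by positivity)
  refine h2.trans (le_of_eq ?_)
  ring

/-- There is a monotone Lipschitz function which fails to be differentiable from the right on a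
dense set that is large in the sense of Hausdorff dimension. -/
theorem exists_monotone_lipschitz_not_rightDifferentiable :
    ∃ (F : ℝ → ℝ) (T : Set ℝ), Monotone F ∧ LipschitzWith 2 F ∧ Dense T ∧
      (∀ x ∈ T, ¬ DifferentiableWithinAt ℝ F (Ioi x) x) ∧
      ∀ r : ℝ, r < 1 → ∃ (A : Set ℝ) (f : ℝ → ℝ) (c e : NNReal), A ⊆ T ∧ r ≤ e ∧ 0 < e ∧ e ≤ 1 ∧
        HolderOnWith c e f A ∧ Icc 0 1 ⊆ f '' A := by
  obtain ⟨enum, henum⟩ := exists_surjective_nat (ℚ × ℕ)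
  set C : ℕ → Set ℝ := fun i => translatedSparseSet (enum i).1 ((enum i).2 + 2) with hC
  have hmem : ∀ (q : ℚ) (m : ℕ), translatedSparseSet q (m + 2) ⊆ {x | ∃ i, x ∈ C i} := by
    intro q m x hx
    obtain ⟨i, hi⟩ := henum (q, m)
    exact ⟨i, by simpa [hC, hi] using hx⟩
  have hLip : ∀ x y, x ≤ y → oscSum C y - oscSum C x ∈ Icc 0 (4 / 3 * (y - x)) :=
    fun x y h => oscSum_sub_mem C h
  refine ⟨oscSum C, {x | ∃ i, x ∈ C i}, fun x y h => by linarith [(hLip x y h).1], ?_, ?_, ?_, ?_⟩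
  · refine LipschitzWith.of_le_add_mul _ fun x y => ?_
    rw [Real.dist_eq, NNReal.coe_ofNat]
    rcases le_total x y with h | h
    · have := (hLip x y h).1
      have := abs_nonneg (x - y)
      linarith
    · have := (hLip y x h).2
      rw [abs_of_nonneg (by linarith)]
      linarith
  · refine Rat.denseRange_cast.mono ?_
    rintro _ ⟨q, rfl⟩
    exact hmem q 0 (mem_translatedSparseSet_self _ (by norm_num))
  · intro x hx
    refine not_differentiableWithinAt_oscSum (fun i => isClosed_translatedSparseSet _ _)
      (fun i => ⟨_, mem_translatedSparseSet_self _ (by omega)⟩)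
      (fun i => (rightPorous_sparseSet (by omega)).translate _) hx
  · intro r hr
    -- Asking for an exponent of at least 1/2 as well keeps it positive when r ≤ 0.
    obtain ⟨m, hm, hrm⟩ := exists_sparseExponent_ge (max_lt hr one_half_lt_one)
    obtain ⟨m, rfl⟩ : ∃ k, m = k + 2 := ⟨m - 2, by omega⟩
    obtain ⟨f, c, hf, hsurj⟩ := exists_holderOnWith_translatedSparseSet ((0 : ℚ) : ℝ) hm
    refine ⟨_, f, c, _, hmem 0 m, (le_max_left _ _).trans hrm, ?_, sparseExponent_le_one _, hf,
      hsurj⟩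
    have := (le_max_right _ _).trans hrm
    exact_mod_cast (show (0 : ℝ) < sparseExponent (m + 2) by linarith)

/-! ### Nearest points of convex sets -/

/-- `p` is the foot of `y` on the convex set `K`. -/
def IsFoot {E : Type*} [NormedAddCommGroup E] [InnerProductSpace ℝ E] (K : Set E) (y p : E) :
    Prop :=
  p ∈ K ∧ ∀ z ∈ K, inner ℝ (y - p) (z - p) ≤ 0

namespace IsFoot

variable {E : Type*} [NormedAddCommGroup E] [InnerProductSpace ℝ E] {K : Set E} {y z p q : E}

lemma sq_add_sq_le (h : IsFoot K y p) (hz : z ∈ K) :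
    ‖y - p‖ ^ 2 + ‖z - p‖ ^ 2 ≤ ‖y - z‖ ^ 2 := by
  have h1 := norm_sub_sq_real (y - p) (z - p)
  rw [sub_sub_sub_cancel_right] at h1
  linarith [h.2 z hz]

lemma norm_le (h : IsFoot K y p) (hz : z ∈ K) : ‖y - p‖ ≤ ‖y - z‖ := by
  refine le_of_sq_le_sq ?_ (norm_nonneg _)
  nlinarith [h.sq_add_sq_le hz, sq_nonneg ‖z - p‖]

lemma infDist_eq (h : IsFoot K y p) : infDist y K = ‖y - p‖ := by
  refine le_antisymm ?_ ?_
  · rw [← dist_eq_norm]; exact infDist_le_dist_of_mem h.1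
  · refine (le_infDist ⟨p, h.1⟩).2 fun z hz => ?_
    rw [dist_eq_norm]; exact h.norm_le hz

lemma nearestPoints_eq (h : IsFoot K y p) : nearestPoints K y = {p} := by
  ext z
  simp only [nearestPoints, mem_ofPred_eq, mem_singleton_iff, h.infDist_eq]
  constructor
  · rintro ⟨hz, hd⟩
    have := h.sq_add_sq_le hz
    rw [hd] at this
    have h0 : ‖z - p‖ = 0 := by nlinarith [norm_nonneg (z - p)]
    exact sub_eq_zero.1 (norm_eq_zero.1 h0)
  · rintro rfl
    exact ⟨h.1, rfl⟩

lemma eq_of_mem (h : IsFoot K y p) (hy : y ∈ K) : y = p := by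
  have := h.2 y hy
  rw [real_inner_self_nonpos, sub_eq_zero] at this
  exact this

lemma norm_sub_le (h : IsFoot K y p) (h' : IsFoot K z q) : ‖p - q‖ ≤ ‖y - z‖ := by
  have h1 := h.2 q h'.1
  have h2 := h'.2 p h.1
  have h3 : ‖p - q‖ ^ 2 ≤ inner ℝ (y - z) (p - q) := by
    have e1 : inner ℝ (y - p) (q - p) = - inner ℝ (y - p) (p - q) := by
      rw [← inner_neg_right, neg_sub]
    have e2 : inner ℝ (y - z) (p - q) =
        inner ℝ (y - p) (p - q) + inner ℝ (p - q) (p - q) - inner ℝ (z - q) (p - q) := by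
      rw [← inner_add_left, ← inner_sub_left]
      congr 1
      abel
    rw [← real_inner_self_eq_norm_sq]
    linarith
  have h4 := real_inner_le_norm (y - z) (p - q)
  rcases (norm_nonneg (p - q)).eq_or_lt with h0 | h0
  · rw [← h0]; exact norm_nonneg _
  · nlinarith

lemma unique (h : IsFoot K y p) (h' : IsFoot K y q) : p = q := by
  have := h.norm_sub_le h'
  rw [sub_self, norm_zero] at this
  exact sub_eq_zero.1 (norm_le_zero_iff.1 this)

/-- This says that y - p is a subgradient at y of half the squared distance function. -/
lemma inner_le (h : IsFoot K y p) (h' : IsFoot K z q) :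
    inner ℝ (y - p) (z - y) ≤ ‖z - q‖ ^ 2 / 2 - ‖y - p‖ ^ 2 / 2 := by
  have h1 := h.2 q h'.1
  have e1 : inner ℝ (y - p) (z - y) =
      inner ℝ (y - p) (z - q) + inner ℝ (y - p) (q - p) - inner ℝ (y - p) (y - p) := by
    rw [← inner_add_right, ← inner_sub_right]
    congr 1
    abel
  have h2 := real_inner_le_norm (y - p) (z - q)
  rw [real_inner_self_eq_norm_sq] at e1
  nlinarith [sq_nonneg (‖z - q‖ - ‖y - p‖)]

end IsFoot

lemma exists_isFoot {E : Type*} [NormedAddCommGroup E] [InnerProductSpace ℝ E] [CompleteSpace E]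
    {K : Set E} (hcl : IsClosed K) (hconv : Convex ℝ K) (hne : K.Nonempty) (y : E) :
    ∃ p, IsFoot K y p := by
  obtain ⟨p, hp, h⟩ := exists_norm_eq_iInf_of_complete_convex hne hcl.isComplete hconv y
  exact ⟨p, hp, (norm_eq_iInf_iff_real_inner_le_zero hconv hp).1 h⟩

/-! ### From second order expansions of the distance to directional derivatives of the projection -/

lemma isLittleO_half_sq {D : ℝ → ℝ} {d b c : ℝ}
    (h : (fun t => D t - (d + t * b + t ^ 2 * c)) =o[𝓝[>] 0] fun t : ℝ => t ^ 2) :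
    (fun t => D t ^ 2 / 2 - (d ^ 2 / 2 + t * (d * b) + t ^ 2 * (d * c + b ^ 2 / 2)))
      =o[𝓝[>] 0] fun t : ℝ => t ^ 2 := by
  set R : ℝ → ℝ := fun t => D t - (d + t * b + t ^ 2 * c) with hR
  have hid : Tendsto (fun t : ℝ => t) (𝓝[>] 0) (𝓝 0) := tendsto_id.mono_left nhdsWithin_le_nhds
  have hsq : Tendsto (fun t : ℝ => t ^ 2) (𝓝[>] 0) (𝓝 0) := by simpa using hid.pow 2
  have hR0 : Tendsto R (𝓝[>] 0) (𝓝 0) := h.trans_tendsto hsq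
  have hbdd : (fun t => R t / 2 + (d + t * b + t ^ 2 * c)) =O[𝓝[>] 0] fun _ => (1 : ℝ) := by
    have : Tendsto (fun t => R t / 2 + (d + t * b + t ^ 2 * c)) (𝓝[>] 0)
        (𝓝 (0 / 2 + (d + 0 * b + 0 * c))) :=
      (hR0.div_const 2).add ((tendsto_const_nhds.add (hid.mul_const b)).add (hsq.mul_const c))
    exact this.isBigO_one ℝ
  have h1 : (fun t => R t * (R t / 2 + (d + t * b + t ^ 2 * c))) =o[𝓝[>] 0] fun t : ℝ => t ^ 2 := by
    simpa using h.mul_isBigO hbdd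
  have h2 : (fun t : ℝ => t ^ 2 * (t * (b * c) + t ^ 2 * (c ^ 2 / 2)))
      =o[𝓝[>] 0] fun t : ℝ => t ^ 2 := by
    have h3 : Tendsto (fun t : ℝ => t * (b * c) + t ^ 2 * (c ^ 2 / 2)) (𝓝[>] 0) (𝓝 0) := by
      simpa using (hid.mul_const (b * c)).add (hsq.mul_const (c ^ 2 / 2))
    have := (isBigO_refl (fun t : ℝ => t ^ 2) (𝓝[>] 0)).mul_isLittleO
      ((isLittleO_one_iff ℝ).2 h3)
    simpa using this
  refine (h1.add h2).congr_left fun t => ?_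
  simp only [hR]
  ring

lemma IsLittleO.exists_forall_Ioc {f : ℝ → ℝ} {n : ℕ}
    (h : f =o[𝓝[>] 0] fun t : ℝ => t ^ n) {ε : ℝ} (hε : 0 < ε) :
    ∃ δ > 0, ∀ t, 0 < t → t ≤ δ → |f t| ≤ ε * t ^ n := by
  have h1 := h.def hε
  rw [eventually_nhdsWithin_iff, Metric.eventually_nhds_iff] at h1
  obtain ⟨δ, hδ, H⟩ := h1
  refine ⟨δ / 2, by positivity, fun t ht0 ht => ?_⟩
  have := H (y := t) (by rw [Real.dist_eq, sub_zero, abs_of_pos ht0]; linarith) ht0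
  rwa [Real.norm_eq_abs, Real.norm_of_nonneg (by positivity)] at this

/-- Dividing by l t for a small positive l and for its negative bounds a t / t from both sides by P,
up to l Q and η / l. -/
lemma exists_abs_sub_le_of_forall_slope {a : ℝ → ℝ} {P Q : ℝ}
    (h : ∀ l : ℝ, ∀ η > 0, ∃ δ > 0, ∀ t, 0 < t → t ≤ δ →
      l * t * a t ≤ t ^ 2 * (l * P + l ^ 2 * Q) + η * t ^ 2) {ε : ℝ} (hε : 0 < ε) :
    ∃ δ > 0, ∀ t, 0 < t → t ≤ δ → |a t - t * P| ≤ ε * t := by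
  set l : ℝ := ε / (2 * (|Q| + 1)) with hl
  have hQ := abs_nonneg Q
  have hlpos : 0 < l := by positivity
  have hlQ : l * |Q| ≤ ε / 2 := by
    rw [hl, div_mul_eq_mul_div, div_le_div_iff₀ (by positivity) (by positivity)]
    nlinarith
  have hlQ' : l * Q ≤ ε / 2 := le_trans (by gcongr; exact le_abs_self Q) hlQ
  obtain ⟨δ₁, hδ₁, H₁⟩ := h l (l * (ε / 2)) (by positivity)
  obtain ⟨δ₂, hδ₂, H₂⟩ := h (-l) (l * (ε / 2)) (by positivity)
  refine ⟨min δ₁ δ₂, lt_min hδ₁ hδ₂, fun t ht0 ht => ?_⟩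
  have h1 := H₁ t ht0 (ht.trans (min_le_left _ _))
  have h2 := H₂ t ht0 (ht.trans (min_le_right _ _))
  have hlt : 0 < l * t := by positivity
  have h3 : t * (l * Q) ≤ t * (ε / 2) := by gcongr
  rw [abs_le]
  constructor
  · have : (l * t) * (t * P - a t) ≤ (l * t) * (t * (l * Q) + ε / 2 * t) := by linarith
    have := le_of_mul_le_mul_left this hlt
    linarith
  · have : (l * t) * (a t - t * P) ≤ (l * t) * (t * (l * Q) + ε / 2 * t) := by linarith
    have := le_of_mul_le_mul_left this hlt
    linarith

lemma Plane.norm_le_add (u : Plane) : ‖u‖ ≤ |u 0| + |u 1| := by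
  rw [EuclideanSpace.norm_eq, Fin.sum_univ_two]
  refine Real.sqrt_le_iff.2 ⟨by positivity, ?_⟩
  simp only [Real.norm_eq_abs]
  nlinarith [abs_nonneg (u 0), abs_nonneg (u 1)]

lemma Plane.inner_eq (u v : Plane) : inner ℝ u v = u 0 * v 0 + u 1 * v 1 := by
  simp [PiLp.inner_apply, Fin.sum_univ_two, mul_comm]

/-- Where the distance from a convex set is pointwise twice differentiable, the nearest point
projection is directionally differentiable. -/
theorem PointwiseTwiceDifferentiableAt.multiDirDifferentiableAt_nearestPoints {K : Set Plane}
    (hcl : IsClosed K) (hconv : Convex ℝ K) (hne : K.Nonempty) {x : Plane}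
    (h : PointwiseTwiceDifferentiableAt (fun y => infDist y K) x) :
    MultiDirDifferentiableAt (nearestPoints K) x := by
  obtain ⟨L, B, hLB⟩ := h
  choose ξ hξ using exists_isFoot hcl hconv hne
  set d := infDist x K with hd
  have hray : ∀ a : Plane, (fun t : ℝ => ‖x + t • a - ξ (x + t • a)‖ ^ 2 / 2 -
      (d ^ 2 / 2 + t * (d * L a) + t ^ 2 * (d * B a a + (L a) ^ 2 / 2)))
      =o[𝓝[>] 0] fun t : ℝ => t ^ 2 := by
    intro a
    refine isLittleO_half_sq ?_
    have htend : Tendsto (fun t : ℝ => x + t • a) (𝓝[>] 0) (𝓝 x) := by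
      have : Continuous fun t : ℝ => x + t • a := by fun_prop
      simpa using (this.tendsto 0).mono_left (nhdsWithin_le_nhds (s := Ioi 0))
    have h1 := hLB.comp_tendsto htend
    have h2 : ((fun y => ‖y - x‖ ^ 2) ∘ fun t : ℝ => x + t • a) =O[𝓝[>] 0]
        fun t : ℝ => t ^ 2 := by
      refine IsBigO.of_bound (‖a‖ ^ 2) (Eventually.of_forall fun t => ?_)
      simp [norm_smul, mul_pow, mul_comm]
    refine (h1.trans_isBigO h2).congr_left fun t => ?_
    simp only [Function.comp, add_sub_cancel_left, map_smul, smul_apply,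
      smul_eq_mul]
    rw [(hξ (x + t • a)).infDist_eq]
    ring
  -- The subgradient inequality between x + t v and x + t (v + l e) bounds the e-component of y - ξ
  -- y by a difference of two quadratic expansions; the part linear in l is the wanted derivative.
  have hcoord : ∀ v e : Plane, ∀ ε > 0, ∃ δ > 0, ∀ t : ℝ, 0 < t → t ≤ δ →
      |(inner ℝ (x + t • v - ξ (x + t • v)) e - d * L e)
        - t * (d * (B v e + B e v) + L v * L e)| ≤ ε * t := by
    intro v e ε hε
    refine exists_abs_sub_le_of_forall_slope (Q := d * B e e + (L e) ^ 2 / 2)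
      (fun l η hη => ?_) hε
    obtain ⟨δ₁, hδ₁, H₁⟩ := IsLittleO.exists_forall_Ioc (hray v) (half_pos hη)
    obtain ⟨δ₂, hδ₂, H₂⟩ := IsLittleO.exists_forall_Ioc (hray (v + l • e)) (half_pos hη)
    refine ⟨min δ₁ δ₂, lt_min hδ₁ hδ₂, fun t ht0 ht => ?_⟩
    have h1 := (abs_le.1 (H₁ t ht0 (ht.trans (min_le_left _ _)))).1
    have h2 := (abs_le.1 (H₂ t ht0 (ht.trans (min_le_right _ _)))).2
    have h3 := (hξ (x + t • v)).inner_le (hξ (x + t • (v + l • e)))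
    have h4 : x + t • (v + l • e) - (x + t • v) = (l * t) • e := by
      rw [smul_add, smul_smul, mul_comm l t]; abel
    rw [h4, inner_smul_right] at h3
    simp only [map_add, map_smul, add_apply, smul_apply,
      smul_eq_mul] at h2
    linarith
  -- For v = 0 the estimate bounds a quantity independent of t by t, so that quantity vanishes.
  have hbase : ∀ e, inner ℝ (x - ξ x) e = d * L e := by
    intro e
    by_contra hne
    have hpos : 0 < |inner ℝ (x - ξ x) e - d * L e| := abs_pos.2 (sub_ne_zero.2 hne)
    obtain ⟨δ, hδ, H⟩ := hcoord 0 e 1 one_pos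
    set A := |inner ℝ (x - ξ x) e - d * L e| with hA
    have h1 := H (min δ (A / 2)) (lt_min hδ (by positivity)) (min_le_left _ _)
    simp only [smul_zero, add_zero, map_zero, zero_apply, zero_mul, mul_zero,
      sub_zero] at h1
    have := min_le_right δ (A / 2)
    linarith
  refine ⟨ξ x, (hξ x).nearestPoints_eq, fun v => ?_⟩
  let e : Fin 2 → Plane := fun i => EuclideanSpace.single i 1
  have he : ∀ (u : Plane) (i : Fin 2), inner ℝ u (e i) = u i := by
    intro u i
    fin_cases i <;> simp [e, Plane.inner_eq]
  refine ⟨WithLp.toLp 2 fun i => v i - (d * (B v (e i) + B (e i) v) + L v * L (e i)),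
    fun ε hε => ?_⟩
  obtain ⟨δ₀, hδ₀, H₀⟩ := hcoord v (e 0) (ε / 2) (by positivity)
  obtain ⟨δ₁, hδ₁, H₁⟩ := hcoord v (e 1) (ε / 2) (by positivity)
  refine ⟨min δ₀ δ₁, lt_min hδ₀ hδ₁, fun t ht0 ht y hy => ?_⟩
  rw [(hξ _).nearestPoints_eq, mem_singleton_iff] at hy
  subst hy
  have h0 := H₀ t ht0 (ht.trans (min_le_left _ _))
  have h1 := H₁ t ht0 (ht.trans (min_le_right _ _))
  rw [← hbase, he, he] at h0 h1
  refine (Plane.norm_le_add _).trans ?_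
  have hrw : ε * t = ε / 2 * t + ε / 2 * t := by ring
  rw [hrw]
  refine add_le_add ((le_of_eq ?_).trans h0) ((le_of_eq ?_).trans h1)
  all_goals
    rw [← abs_neg]
    congr 1
    simp
    ring

/-! ### Geometry of the epigraph and its normals -/

/-- The epigraph of `g` as a subset of the Euclidean plane. -/
def planeEpigraph (g : ℝ → ℝ) : Set Plane := {z | g (z 0) ≤ z 1}

/-- The point over `x` of the graph of `g`. -/
noncomputable def graphPoint (g : ℝ → ℝ) (x : ℝ) : Plane := !₂[x, g x]

/-- The downward normal vector of a line of slope `m`. -/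
noncomputable def slopeNormal (m : ℝ) : Plane := !₂[m, -1]

/-- The downward unit normal vector of a line of slope `m`. -/
noncomputable def slopeUnitNormal (m : ℝ) : Plane := (√(1 + m ^ 2))⁻¹ • slopeNormal m

/-- The direction vector of a line of slope `m`. -/
noncomputable def slopeTangent (m : ℝ) : Plane := !₂[1, m]

section Vectors

@[simp] lemma graphPoint_zero (g : ℝ → ℝ) (x : ℝ) : graphPoint g x 0 = x := rfl
@[simp] lemma graphPoint_one (g : ℝ → ℝ) (x : ℝ) : graphPoint g x 1 = g x := rfl
@[simp] lemma slopeNormal_zero (m : ℝ) : slopeNormal m 0 = m := rfl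
@[simp] lemma slopeNormal_one (m : ℝ) : slopeNormal m 1 = -1 := rfl
@[simp] lemma slopeTangent_zero (m : ℝ) : slopeTangent m 0 = 1 := rfl
@[simp] lemma slopeTangent_one (m : ℝ) : slopeTangent m 1 = m := rfl

lemma norm_slopeNormal (m : ℝ) : ‖slopeNormal m‖ = √(1 + m ^ 2) := by
  rw [EuclideanSpace.norm_eq, Fin.sum_univ_two]
  congr 1
  simp
  ring

lemma norm_slopeNormal_pos (m : ℝ) : 0 < ‖slopeNormal m‖ := by
  rw [norm_slopeNormal]; positivity

lemma hasDerivWithinAt_vec {a b : ℝ → ℝ} {a' b' x : ℝ} {s : Set ℝ}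
    (ha : HasDerivWithinAt a a' s x) (hb : HasDerivWithinAt b b' s x) :
    HasDerivWithinAt (fun t => (!₂[a t, b t] : Plane)) !₂[a', b'] s x := by
  have h := (ha.smul_const (EuclideanSpace.single 0 1 : Plane)).add
    (hb.smul_const (EuclideanSpace.single 1 1 : Plane))
  refine (h.congr_deriv ?_).congr (fun t _ => ?_) ?_ <;>
  · ext i
    fin_cases i <;> simp

lemma hasDerivAt_slopeUnitNormal (m : ℝ) :
    HasDerivAt slopeUnitNormal (((√(1 + m ^ 2)) ^ 3)⁻¹ • slopeTangent m) m := by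
  have hpos : 0 < 1 + m ^ 2 := by positivity
  have hs : 0 < √(1 + m ^ 2) := Real.sqrt_pos.2 hpos
  have hsq : √(1 + m ^ 2) ^ 2 = 1 + m ^ 2 := Real.sq_sqrt hpos.le
  have h1 : HasDerivAt (fun t : ℝ => (√(1 + t ^ 2))⁻¹) (-(m / √(1 + m ^ 2)) / √(1 + m ^ 2) ^ 2) m := by
    have h0 : HasDerivAt (fun t : ℝ => 1 + t ^ 2) (2 * m) m := by
      simpa using ((hasDerivAt_id m).pow 2).const_add 1
    refine ((h0.sqrt hpos.ne').fun_inv hs.ne').congr_deriv ?_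
    field_simp
  have h2 : HasDerivWithinAt slopeNormal !₂[1, 0] univ m :=
    hasDerivWithinAt_vec (hasDerivWithinAt_id m univ) (hasDerivWithinAt_const _ _ _)
  refine (h1.smul (hasDerivWithinAt_univ.1 h2)).congr_deriv ?_
  ext i
  fin_cases i
  · simp
    field_simp
    linarith
  · simp
    field_simp

end Vectors

section Epigraph

variable {F g : ℝ → ℝ}

lemma tangent_le_of_hasDerivAt_monotone (hF : Monotone F) (hg : ∀ x, HasDerivAt g (F x) x)
    (x y : ℝ) : g x + F x * (y - x) ≤ g y := by
  have hc : Continuous g := continuous_iff_continuousAt.2 fun x => (hg x).continuousAt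
  rcases lt_trichotomy x y with h | rfl | h
  · obtain ⟨c, hc1, hc2⟩ := exists_hasDerivAt_eq_slope g F h hc.continuousOn fun z _ => hg z
    have h1 : F x ≤ F c := hF hc1.1.le
    rw [hc2, le_div_iff₀ (by linarith)] at h1
    linarith
  · simp
  · obtain ⟨c, hc1, hc2⟩ := exists_hasDerivAt_eq_slope g F h hc.continuousOn fun z _ => hg z
    have h1 : F c ≤ F x := hF hc1.2.le
    rw [hc2, div_le_iff₀ (by linarith)] at h1
    linarith

lemma isClosed_planeEpigraph (hg : Continuous g) : IsClosed (planeEpigraph g) :=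
  isClosed_le (by fun_prop) (by fun_prop)

lemma graphPoint_mem (g : ℝ → ℝ) (x : ℝ) : graphPoint g x ∈ planeEpigraph g := by
  simp [planeEpigraph]

lemma convex_planeEpigraph (hF : Monotone F) (hg : ∀ x, HasDerivAt g (F x) x) :
    Convex ℝ (planeEpigraph g) := by
  intro z hz w hw a b ha hb hab
  simp only [planeEpigraph, mem_ofPred_eq, PiLp.add_apply, PiLp.smul_apply, smul_eq_mul] at *
  set c := a * z 0 + b * w 0 with hc
  have h1 := mul_le_mul_of_nonneg_left
    ((tangent_le_of_hasDerivAt_monotone hF hg c (z 0)).trans hz) ha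
  have h2 := mul_le_mul_of_nonneg_left
    ((tangent_le_of_hasDerivAt_monotone hF hg c (w 0)).trans hw) hb
  have h3 : a * (g c + F c * (z 0 - c)) + b * (g c + F c * (w 0 - c)) = g c := by
    have hb' : b = 1 - a := by linarith
    rw [hc, hb']; ring
  linarith

lemma isFoot_graphPoint (hF : Monotone F) (hg : ∀ x, HasDerivAt g (F x) x) (x : ℝ) {ρ : ℝ}
    (hρ : 0 ≤ ρ) :
    IsFoot (planeEpigraph g) (graphPoint g x + ρ • slopeNormal (F x)) (graphPoint g x) := by
  refine ⟨graphPoint_mem g x, fun z hz => ?_⟩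
  have h1 := (tangent_le_of_hasDerivAt_monotone hF hg x (z 0)).trans hz
  rw [add_sub_cancel_left, Plane.inner_eq]
  simp only [PiLp.sub_apply, PiLp.smul_apply, graphPoint_zero, graphPoint_one, slopeNormal_zero,
    slopeNormal_one, smul_eq_mul]
  have := mul_le_mul_of_nonneg_left h1 hρ
  linarith

/-- Testing the foot inequality with vertical moves puts a on the graph; testing along the graph
gives a maximum at a, and its vanishing derivative says that y - a is normal to the tangent line. -/
lemma IsFoot.exists_eq_of_notMem (hg : ∀ x, HasDerivAt g (F x) x) {y a : Plane}
    (h : IsFoot (planeEpigraph g) y a) (hy : y ∉ planeEpigraph g) :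
    ∃ ρ : ℝ, 0 < ρ ∧ a = graphPoint g (a 0) ∧
      y = graphPoint g (a 0) + ρ • slopeNormal (F (a 0)) := by
  have ha : g (a 0) ≤ a 1 := h.1
  have hy' : y 1 < g (y 0) := not_le.1 hy
  have hin : ∀ s t : ℝ, g s ≤ t → (y 0 - a 0) * (s - a 0) + (y 1 - a 1) * (t - a 1) ≤ 0 := by
    intro s t hst
    have := h.2 !₂[s, t] hst
    rw [Plane.inner_eq] at this
    simpa using this
  have h1 : y 1 ≤ a 1 := by
    have := hin (a 0) (a 1 + 1) (by linarith)
    linarith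
  have hag : a 1 = g (a 0) := by
    by_contra hne
    have hlt : g (a 0) < a 1 := lt_of_le_of_ne ha (Ne.symm hne)
    have h2 := hin (a 0) (g (a 0)) le_rfl
    have h3 : y 1 = a 1 := by
      by_contra hne'
      have : y 1 < a 1 := lt_of_le_of_ne h1 hne'
      nlinarith
    have h4 := hin (y 0) (g (y 0)) le_rfl
    rw [h3, sub_self, zero_mul, add_zero] at h4
    have h5 : y 0 = a 0 := by nlinarith
    rw [h5] at hy'
    linarith
  have hmax : IsLocalMax (fun t => (y 0 - a 0) * (t - a 0) + (y 1 - a 1) * (g t - a 1)) (a 0) := by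
    refine Eventually.of_forall fun t => ?_
    have := hin t (g t) le_rfl
    simp only [hag] at *
    linarith
  have hder : HasDerivAt (fun t => (y 0 - a 0) * (t - a 0) + (y 1 - a 1) * (g t - a 1))
      ((y 0 - a 0) * 1 + (y 1 - a 1) * F (a 0)) (a 0) :=
    (((hasDerivAt_id _).sub_const _).const_mul _).add (((hg _).sub_const _).const_mul _)
  have hzero := hmax.hasDerivAt_eq_zero hder
  have hpos : 0 < a 1 - y 1 := by
    rcases h1.lt_or_eq with h | h
    · linarith
    · rw [h, sub_self, zero_mul, add_zero, mul_one] at hzero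
      have h5 : y 0 = a 0 := by linarith
      rw [h5, h, hag] at hy'
      exact absurd hy' (lt_irrefl _)
  refine ⟨a 1 - y 1, hpos, ?_, ?_⟩
  · ext i
    fin_cases i
    · simp
    · simpa using hag
  · ext i
    fin_cases i
    · simp; linarith
    · simp; linarith

/-- The point lies on a parallel to the tangent strictly below it, and the graph stays above its
tangent. -/
lemma add_smul_slopeNormal_notMem (hF : Monotone F) (hg : ∀ x, HasDerivAt g (F x) x) (x t : ℝ)
    {ρ : ℝ} (hρ : 0 < ρ) :
    graphPoint g x + ρ • slopeNormal (F x) + t • slopeTangent (F x) ∉ planeEpigraph g := by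
  have h := tangent_le_of_hasDerivAt_monotone hF hg x (x + ρ * F x + t)
  simp only [planeEpigraph, mem_ofPred_eq, not_le, PiLp.add_apply, PiLp.smul_apply, smul_eq_mul,
    graphPoint_zero, graphPoint_one, slopeNormal_zero, slopeNormal_one, slopeTangent_zero,
    slopeTangent_one, mul_one]
  nlinarith [mul_nonneg hρ.le (sq_nonneg (F x))]

lemma frontier_planeEpigraph (hg : Continuous g) :
    frontier (planeEpigraph g) = range (graphPoint g) := by
  have hrange : range (graphPoint g) = {z : Plane | g (z 0) = z 1} := by
    ext z
    constructor
    · rintro ⟨x, rfl⟩; rfl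
    · intro hz
      refine ⟨z 0, ?_⟩
      ext i
      fin_cases i
      · simp
      · simpa using hz
  rw [hrange]
  refine Subset.antisymm (frontier_le_subset_eq (by fun_prop) (by fun_prop)) fun z hz => ?_
  have hz' : g (z 0) = z 1 := hz
  rw [frontier_eq_closure_inter_closure]
  refine ⟨subset_closure hz'.le, ?_⟩
  have hlim : Tendsto (fun t : ℝ => z + t • slopeNormal 0) (𝓝[>] 0) (𝓝 z) := by
    have : Continuous fun t : ℝ => z + t • slopeNormal 0 := by fun_prop
    simpa using (this.tendsto 0).mono_left (nhdsWithin_le_nhds (s := Ioi 0))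
  refine mem_closure_of_tendsto hlim ?_
  filter_upwards [self_mem_nhdsWithin] with t ht
  have ht' : (0 : ℝ) < t := ht
  simp [planeEpigraph, hz', ht']

/-- At a boundary point where the slope is not differentiable from the right, the nearest point
projection restricted to the level sets of the distance function is not differentiable. -/
theorem not_multiDifferentiableAt_distLevel (hF : Monotone F) (hL : LipschitzWith 2 F)
    (hg : ∀ x, HasDerivAt g (F x) x) {x r : ℝ} (hr : 0 < r)
    (hx : ¬ DifferentiableWithinAt ℝ F (Ioi x) x) :
    ¬ MultiDifferentiableAt
      (multiRestrict (nearestPoints (planeEpigraph g)) (distLevel (planeEpigraph g) r))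
      (graphPoint g x + r • slopeUnitNormal (F x)) := by
  -- q lifts the boundary to the level set at distance r, and ξ sends q y back to the graph point
  -- over y.
  set q : ℝ → Plane := fun y => graphPoint g y + r • slopeUnitNormal (F y) with hq
  have hfoot : ∀ y, IsFoot (planeEpigraph g) (q y) (graphPoint g y) := by
    intro y
    have := isFoot_graphPoint hF hg y (ρ := r * (√(1 + F y ^ 2))⁻¹) (by positivity)
    rwa [← smul_smul] at this
  have hdist : ∀ y, infDist (q y) (planeEpigraph g) = r := by
    intro y
    have h0 := norm_slopeNormal_pos (F y)
    rw [(hfoot y).infDist_eq, hq]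
    simp only [add_sub_cancel_left, slopeUnitNormal, norm_smul, ← norm_slopeNormal, norm_inv,
      norm_norm, Real.norm_of_nonneg hr.le]
    field_simp
  have hT : ∀ y, multiRestrict (nearestPoints (planeEpigraph g))
      (distLevel (planeEpigraph g) r) (q y) = {graphPoint g y} := by
    intro y
    ext z
    simp [multiRestrict, distLevel, hdist y, (hfoot y).nearestPoints_eq]
  rintro ⟨p, hp, L, hLd⟩
  obtain rfl : graphPoint g x = p := singleton_injective ((hT x).symm.trans hp)
  set τ := slopeTangent (F x) with hτ
  set κ : ℝ := (√(1 + F x ^ 2) ^ 3)⁻¹ with hκ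
  have hκpos : 0 < κ := by positivity
  set l := 𝓝[>] x with hl
  have hFO : (fun y => F y - F x) =O[l] fun y => y - x := by
    refine IsBigO.of_bound 2 (Eventually.of_forall fun y => ?_)
    simpa [← dist_eq_norm] using hL.dist_le_mul y x
  have hFt : Tendsto F l (𝓝 (F x)) := hL.continuous.continuousWithinAt
  have hν : (fun y => slopeUnitNormal (F y) - slopeUnitNormal (F x) - (F y - F x) • (κ • τ))
      =o[l] fun y => y - x :=
    ((hasDerivAt_iff_isLittleO.1 (hasDerivAt_slopeUnitNormal (F x))).comp_tendsto hFt).trans_isBigO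
      hFO
  have hp : (fun y => graphPoint g y - graphPoint g x - (y - x) • τ) =o[l] fun y => y - x :=
    hasDerivWithinAt_iff_isLittleO.1
      (hasDerivWithinAt_vec (hasDerivWithinAt_id x (Ioi x)) (hg x).hasDerivWithinAt)
  -- To first order both the graph point and its unit normal move along the tangent τ, the normal
  -- with speed κ per unit change of slope.
  have hqo : (fun y => q y - q x - ((y - x) + r * κ * (F y - F x)) • τ) =o[l] fun y => y - x := by
    refine (hp.add (hν.const_smul_left r)).congr_left fun y => ?_
    simp only [hq, Pi.smul_apply]
    module
  have hqO : (fun y => q y - q x) =O[l] fun y => y - x := by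
    have h1 : (fun y => ((y - x) + r * κ * (F y - F x)) • τ) =O[l] fun y => y - x := by
      have h2 : (fun y => (y - x) + r * κ * (F y - F x)) =O[l] fun y => y - x :=
        (isBigO_refl _ _).add (hFO.const_mul_left _)
      simpa using h2.smul (isBigO_const_const τ (one_ne_zero (α := ℝ)) l)
    refine (hqo.isBigO.add h1).congr_left fun y => ?_
    abel
  have hqt : Tendsto (fun y => q y - q x) l (𝓝 0) := by
    refine hqO.trans_tendsto ?_
    have : Continuous fun y : ℝ => y - x := by fun_prop
    simpa using (this.tendsto x).mono_left (nhdsWithin_le_nhds (s := Ioi x))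
  have hdiff : (fun y => graphPoint g y - graphPoint g x - L (q y - q x)) =o[l]
      fun y => y - x := by
    refine IsLittleO.trans_isBigO (g := fun y => q y - q x) ?_ hqO
    refine IsLittleO.of_bound fun ε hε => ?_
    obtain ⟨δ, hδ, H⟩ := hLd ε hε
    filter_upwards [(hqt.norm.eventually_le_const (u := δ) (by simpa using hδ))] with y hy
    exact H (q y) hy _ (by rw [hT]; rfl)
  have hcomb : (fun y => (y - x) • τ - ((y - x) + r * κ * (F y - F x)) • L τ) =o[l]
      fun y => y - x := by
    have h1 : (fun y => L (q y - q x - ((y - x) + r * κ * (F y - F x)) • τ)) =o[l]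
        fun y => y - x := (L.isBigO_comp _ _).trans_isLittleO hqo
    refine ((hdiff.sub hp).add h1).congr_left fun y => ?_
    simp only [map_sub, map_smul]
    abel
  set A : ℝ := inner ℝ τ τ with hA
  set ℓ : ℝ := inner ℝ τ (L τ) with hℓ
  have hApos : 0 < A := by
    rw [hA, Plane.inner_eq, hτ]
    simp only [slopeTangent_zero, slopeTangent_one]
    nlinarith [mul_self_nonneg (F x)]
  -- Pairing with τ leaves a scalar relation. If ℓ ≠ 0 it can be solved for F y - F x, which gives a
  -- right derivative; if ℓ = 0 it says that y - x is o(y - x).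
  have hscal : (fun y => (y - x) * A - ((y - x) + r * κ * (F y - F x)) * ℓ) =o[l]
      fun y => y - x := by
    refine (((innerSL ℝ τ).isBigO_comp _ _).trans_isLittleO hcomb).congr_left fun y => ?_
    simp [inner_sub_right, inner_smul_right, hA, hℓ]
  by_cases hℓ0 : ℓ = 0
  · simp only [hℓ0, mul_zero, sub_zero] at hscal
    have h1 := hscal.const_mul_left A⁻¹
    have h2 : (fun y => y - x) =o[l] fun y => y - x := by
      refine h1.congr_left fun y => ?_
      field_simp
    have h3 := h2.def (c := 1 / 2) (by norm_num)
    obtain ⟨y, hy, hyx⟩ := (h3.and self_mem_nhdsWithin).exists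
    have : 0 < ‖y - x‖ := norm_pos_iff.2 (sub_ne_zero.2 (ne_of_gt hyx))
    linarith
  · refine hx (HasDerivWithinAt.differentiableWithinAt (f' := (A - ℓ) / (ℓ * r * κ)) ?_)
    refine hasDerivWithinAt_iff_isLittleO.2 ((hscal.const_mul_left (-(ℓ * r * κ)⁻¹)).congr_left
      fun y => ?_)
    rw [smul_eq_mul]
    field_simp
    ring

end Epigraph

/-! ### Failure of directional differentiability along normal lines -/

/-- If `X` moves from `x` along a curve with positive speed, along which the increments of `F` are
asymptotically linear, then `F` has a right derivative at `x`. -/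
lemma hasDerivWithinAt_Ioi_of_curve {F X : ℝ → ℝ} {x w k : ℝ} (hX : Continuous X) (hX0 : X 0 = x)
    (hw : 0 < w) (h1 : (fun t => X t - x - t * w) =o[𝓝[>] 0] fun t : ℝ => t)
    (h2 : (fun t => F (X t) - F x - t * k) =o[𝓝[>] 0] fun t : ℝ => t) :
    HasDerivWithinAt F (k / w) (Ioi x) x := by
  have h3 : (fun t => F (X t) - F x - (X t - x) * (k / w)) =o[𝓝[>] 0] fun t : ℝ => t := by
    refine (h2.sub (h1.const_mul_left (k / w))).congr_left fun t => ?_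
    field_simp
    ring
  rw [hasDerivWithinAt_iff_isLittleO]
  refine IsLittleO.of_bound fun ε hε => ?_
  obtain ⟨δ₁, hδ₁, H₁⟩ := IsLittleO.exists_forall_Ioc (n := 1) (by simpa using h1) (half_pos hw)
  obtain ⟨δ₂, hδ₂, H₂⟩ := IsLittleO.exists_forall_Ioc (n := 1) (by simpa using h3)
    (ε := ε * (w / 2)) (by positivity)
  set δ := min δ₁ δ₂ with hδ
  have hδpos : 0 < δ := lt_min hδ₁ hδ₂
  have hlow : ∀ t, 0 < t → t ≤ δ → t * (w / 2) ≤ X t - x := by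
    intro t ht0 ht
    have := (abs_le.1 (H₁ t ht0 (ht.trans (min_le_left _ _)))).1
    rw [pow_one] at this
    linarith
  have hxδ : x < X δ := by
    have := hlow δ hδpos le_rfl
    have : 0 < δ * (w / 2) := by positivity
    linarith
  -- By the intermediate value theorem every y slightly to the right of x is some X t, with t at
  -- most a multiple of y - x.
  filter_upwards [Ioo_mem_nhdsGT hxδ] with y hy
  obtain ⟨t, ht, rfl⟩ := intermediate_value_Icc hδpos.le hX.continuousOn
    (show y ∈ Icc (X 0) (X δ) from ⟨by rw [hX0]; exact hy.1.le, hy.2.le⟩)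
  have ht0 : 0 < t := by
    refine lt_of_le_of_ne ht.1 fun h => ?_
    rw [← h, hX0] at hy
    exact lt_irrefl _ hy.1
  have e1 := hlow t ht0 ht.2
  have e2 := H₂ t ht0 (ht.2.trans (min_le_right _ _))
  rw [smul_eq_mul, Real.norm_eq_abs, Real.norm_of_nonneg (by linarith [hy.1])]
  rw [pow_one] at e2
  calc _ ≤ ε * (w / 2) * t := e2
    _ = ε * (t * (w / 2)) := by ring
    _ ≤ _ := by gcongr

/-- On the normal line over a boundary point where the slope is not differentiable from the right,
the nearest point projection is not directionally differentiable. -/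
theorem not_multiDirDifferentiableAt_nearestPoints {F g : ℝ → ℝ} (hF : Monotone F)
    (hL : LipschitzWith 2 F) (hg : ∀ x, HasDerivAt g (F x) x) {x ρ : ℝ} (hρ : 0 < ρ)
    (hx : ¬ DifferentiableWithinAt ℝ F (Ioi x) x) :
    ¬ MultiDirDifferentiableAt (nearestPoints (planeEpigraph g))
      (graphPoint g x + ρ • slopeNormal (F x)) := by
  have hgc : Continuous g := continuous_iff_continuousAt.2 fun x => (hg x).continuousAt
  set K := planeEpigraph g with hK
  choose ξ hξ using exists_isFoot (isClosed_planeEpigraph hgc) (convex_planeEpigraph hF hg)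
    ⟨_, graphPoint_mem g 0⟩
  have hξc : Continuous ξ := by
    refine (LipschitzWith.of_dist_le_mul (K := 1) fun y z => ?_).continuous
    rw [dist_eq_norm, dist_eq_norm, NNReal.coe_one, one_mul]
    exact (hξ y).norm_sub_le (hξ z)
  set y₀ := graphPoint g x + ρ • slopeNormal (F x) with hy₀
  have hξ0 : ξ y₀ = graphPoint g x :=
    (hξ y₀).unique (isFoot_graphPoint hF hg x hρ.le)
  rintro ⟨p, hp, hdir⟩
  obtain ⟨w, hw⟩ := hdir (slopeTangent (F x))
  obtain rfl : graphPoint g x = p := by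
    rw [(hξ y₀).nearestPoints_eq, hξ0] at hp
    exact singleton_injective hp
  -- X t is the abscissa of the foot when y₀ moves parallel to the tangent.
  set X : ℝ → ℝ := fun t => ξ (y₀ + t • slopeTangent (F x)) 0 with hX
  have hXc : Continuous X := by
    have : Continuous fun t : ℝ => ξ (y₀ + t • slopeTangent (F x)) := hξc.comp (by fun_prop)
    fun_prop
  have hX0 : X 0 = x := by simp [hX, hξ0]
  have hex : ∀ t : ℝ, ∃ s : ℝ, x + ρ * F x + t = X t + s * F (X t) ∧
      g x - ρ + t * F x = g (X t) - s := by
    intro t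
    obtain ⟨s, -, -, hs⟩ := (hξ (y₀ + t • slopeTangent (F x))).exists_eq_of_notMem hg
      (add_smul_slopeNormal_notMem hF hg x t hρ)
    refine ⟨s, ?_, ?_⟩
    · simpa [hy₀] using congrArg (fun u : Plane => u 0) hs
    · simpa [hy₀, ← sub_eq_add_neg] using congrArg (fun u : Plane => u 1) hs
  choose σ hσ0 hσ1 using hex
  set l : Filter ℝ := 𝓝[>] 0 with hl
  have hid : Tendsto (fun t : ℝ => t) l (𝓝 0) := tendsto_id.mono_left nhdsWithin_le_nhds
  have hXo : (fun t => X t - x - t * w 0) =o[l] fun t : ℝ => t := by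
    refine IsLittleO.of_bound fun ε hε => ?_
    obtain ⟨δ, hδ, H⟩ := hw ε hε
    filter_upwards [Ioc_mem_nhdsGT hδ] with t ht
    have h1 := H t ht.1 ht.2 (ξ (y₀ + t • slopeTangent (F x))) (by
      rw [(hξ _).nearestPoints_eq]; rfl)
    have h2 := (PiLp.norm_apply_le (ξ (y₀ + t • slopeTangent (F x)) - graphPoint g x - t • w) 0).trans h1
    rw [Real.norm_of_nonneg ht.1.le]
    simpa using h2
  have hXO : (fun t => X t - x) =O[l] fun t : ℝ => t := by
    have h1 : (fun t : ℝ => t * w 0) =O[l] fun t : ℝ => t := by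
      simpa [mul_comm] using (isBigO_refl (fun t : ℝ => t) l).const_mul_left (w 0)
    refine (hXo.isBigO.add h1).congr_left fun t => ?_
    ring
  have hXt : Tendsto X l (𝓝 x) := by
    have := (hXc.tendsto 0).mono_left (nhdsWithin_le_nhds (s := Ioi 0))
    rwa [hX0] at this
  have hFO : (fun t => F (X t) - F x) =O[l] fun t : ℝ => t := by
    refine IsBigO.trans ?_ hXO
    refine IsBigO.of_bound 2 (Eventually.of_forall fun t => ?_)
    simpa [← dist_eq_norm] using hL.dist_le_mul (X t) x
  have hFt : Tendsto (fun t => F (X t) - F x) l (𝓝 0) := hFO.trans_tendsto hid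
  have hgo : (fun t => g (X t) - g x - (X t - x) * F x) =o[l] fun t : ℝ => t :=
    ((hasDerivAt_iff_isLittleO.1 (hg x)).comp_tendsto hXt).trans_isBigO hXO
  have hσo : (fun t => σ t - ρ - t * (F x * (w 0 - 1))) =o[l] fun t : ℝ => t := by
    refine (hgo.add (hXo.const_mul_left (F x))).congr_left fun t => ?_
    linear_combination -hσ1 t
  have hσO : (fun t => σ t - ρ) =O[l] fun t : ℝ => t := by
    have h1 : (fun t : ℝ => t * (F x * (w 0 - 1))) =O[l] fun t : ℝ => t := by
      simpa [mul_comm] using (isBigO_refl (fun t : ℝ => t) l).const_mul_left (F x * (w 0 - 1))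
    refine (hσo.isBigO.add h1).congr_left fun t => ?_
    ring
  have hprod : (fun t => (σ t - ρ) * (F (X t) - F x)) =o[l] fun t : ℝ => t := by
    simpa using hσO.mul_isLittleO ((isLittleO_one_iff ℝ).2 hFt)
  -- The increments of X and σ are linear to first order, and the product of the increments of σ and
  -- F ∘ X is negligible; solving the first coordinate equation for F (X t) - F x gives k t.
  set k := (1 - w 0) * (1 + F x ^ 2) / ρ with hk
  have hFo : (fun t => F (X t) - F x - t * k) =o[l] fun t : ℝ => t := by
    have h1 := ((hXo.add (hσo.const_mul_left (F x))).add hprod).const_mul_left (-ρ⁻¹)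
    refine h1.congr_left fun t => ?_
    rw [hk]
    field_simp
    linear_combination hσ0 t
  -- If w 0 ≤ 0 then k > 0, so the slope grows by at least 3kt/4 while X advances by at most kt/4;
  -- monotonicity and the Lipschitz constant 2 forbid this.
  have hw0 : 0 < w 0 := by
    by_contra hneg
    push Not at hneg
    have hkpos : 0 < k := by
      rw [hk]
      have : 0 < 1 - w 0 := by linarith
      positivity
    obtain ⟨t, ⟨h1, h2⟩, ht⟩ := (((hXo.def (c := k / 4) (by positivity)).and
      (hFo.def (c := k / 4) (by positivity))).and self_mem_nhdsWithin).exists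
    have ht0 : (0 : ℝ) < t := ht
    rw [Real.norm_eq_abs, Real.norm_of_nonneg ht0.le] at h1 h2
    have h1' := (abs_le.1 h1).2
    have h2' := (abs_le.1 h2).1
    have hkt : 0 < k * t := by positivity
    rcases le_total (X t) x with hle | hle
    · have := hF hle
      linarith
    · have h3 := hL.dist_le_mul (X t) x
      rw [Real.dist_eq, Real.dist_eq, abs_of_nonneg (sub_nonneg.2 hle), NNReal.coe_ofNat] at h3
      have h4 := (le_abs_self _).trans h3
      nlinarith
  exact hx (hasDerivWithinAt_Ioi_of_curve hXc hX0 hw0 hXo hFo).differentiableWithinAt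

/-! ### Hausdorff dimension and measure -/

/-- This lets the Hölder exponent e tend to 1 in the dimension bounds. -/
lemma ENNReal.natCast_le_of_forall_le_div {N : ℕ} {d : ENNReal}
    (h : ∀ r : ℝ, r < 1 → ∃ e : NNReal, r ≤ e ∧ 0 < e ∧ (N : ENNReal) ≤ d / e) :
    (N : ENNReal) ≤ d := by
  by_contra hlt
  push Not at hlt
  lift d to NNReal using hlt.ne_top
  have hlt' : (d : ℝ) < N := by exact_mod_cast hlt
  have hN : (0 : ℝ) < N := d.coe_nonneg.trans_lt hlt'
  have hr : (d : ℝ) / N < 1 := (div_lt_one hN).2 hlt'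
  obtain ⟨e, h1, h2, h3⟩ := h (((d : ℝ) / N + 1) / 2) (by linarith)
  rw [← ENNReal.coe_div h2.ne', ← ENNReal.coe_natCast, ENNReal.coe_le_coe, le_div_iff₀ h2] at h3
  have h4 : (N : ℝ) * e ≤ d := by exact_mod_cast h3
  have h5 : (d : ℝ) / N < e := by linarith
  rw [div_lt_iff₀ hN] at h5
  linarith

/-- If `ξ` does not increase distances on `E`, then a Hölder map from the values of `ξ` onto `[0, 1]`
and a real function not increasing distances give a bound from below for the dimension. -/
lemma two_le_dimH_div {E : Set Plane} {ξ : Plane → ℝ} {δ : Plane → ℝ} {f : ℝ → ℝ} {A : Set ℝ}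
    {c e : NNReal} (he0 : 0 < e) (he1 : e ≤ 1) (hf : HolderOnWith c e f A)
    (hξ : ∀ y ∈ E, ∀ z ∈ E, edist (ξ y) (ξ z) ≤ edist y z) (hA : ∀ y ∈ E, ξ y ∈ A)
    (hδ : ∀ y ∈ E, ∀ z ∈ E, edist (δ y) (δ z) ≤ edist y z)
    (hsurj : ∀ x ∈ A, ∀ s ∈ Ioc (0 : ℝ) 1, ∃ y ∈ E, ξ y = x ∧ δ y = s)
    (hfA : Icc 0 1 ⊆ f '' A) : 2 ≤ dimH E / e := by
  -- Values of δ in (0, 1] differ by at most 1, so δ, which is 1-Lipschitz on E, is also Hölder of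
  -- exponent e ≤ 1 there.
  set E' := {y ∈ E | δ y ∈ Ioc (0 : ℝ) 1} with hE'
  have hhol : HolderOnWith (max c 1) e (fun y => (f (ξ y), δ y)) E' := by
    intro y hy z hz
    rw [Prod.edist_eq]
    refine max_le ?_ ?_
    · refine (hf _ (hA y hy.1) _ (hA z hz.1)).trans ?_
      gcongr
      · exact le_max_left _ _
      · exact hξ y hy.1 z hz.1
    · have h1 : edist (δ y) (δ z) ≤ 1 := by
        rw [edist_dist, ← ENNReal.ofReal_one]
        refine ENNReal.ofReal_le_ofReal ?_
        rw [Real.dist_eq, abs_le]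
        constructor <;> linarith [hy.2.1, hy.2.2, hz.2.1, hz.2.2]
      have h2 : edist (δ y) (δ z) ≤ edist (δ y) (δ z) ^ (e : ℝ) := by
        nth_rw 1 [← ENNReal.rpow_one (edist (δ y) (δ z))]
        exact ENNReal.rpow_le_rpow_of_exponent_ge h1 (by exact_mod_cast he1)
      refine h2.trans ?_
      calc edist (δ y) (δ z) ^ (e : ℝ) ≤ edist y z ^ (e : ℝ) := by
            gcongr; exact hδ y hy.1 z hz.1
        _ ≤ _ := by
            refine le_mul_of_one_le_left zero_le ?_
            exact_mod_cast le_max_right c 1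
  have hsub : Icc (0 : ℝ) 1 ×ˢ Ioc (0 : ℝ) 1 ⊆ (fun y => (f (ξ y), δ y)) '' E' := by
    rintro ⟨u, s⟩ ⟨hu, hs⟩
    obtain ⟨x, hx, rfl⟩ := hfA hu
    obtain ⟨y, hy, rfl, rfl⟩ := hsurj x hx s hs
    exact ⟨y, ⟨hy, hs⟩, rfl⟩
  have hdim : dimH (Icc (0 : ℝ) 1 ×ˢ Ioc (0 : ℝ) 1) = 2 := by
    have hn : Icc (0 : ℝ) 1 ×ˢ Ioc (0 : ℝ) 1 ∈ 𝓝 ((1 / 2 : ℝ), (1 / 2 : ℝ)) :=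
      prod_mem_nhds (Icc_mem_nhds (by norm_num) (by norm_num))
        (Ioc_mem_nhds (by norm_num) (by norm_num))
    rw [Real.dimH_of_mem_nhds hn]
    simp
  calc (2 : ENNReal) ≤ dimH ((fun y => (f (ξ y), δ y)) '' E') := hdim ▸ dimH_mono hsub
    _ ≤ dimH E' / e := hhol.dimH_image_le he0
    _ ≤ dimH E / e := by gcongr; exact sep_subset _ _

lemma toLp_graphPoint_slopeUnitNormal_mem {F g : ℝ → ℝ} (hF : Monotone F)
    (hg : ∀ x, HasDerivAt g (F x) x) (x : ℝ) :
    WithLp.toLp 2 (graphPoint g x, slopeUnitNormal (F x)) ∈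
      unitNormalBundle (planeEpigraph g) := by
  have h0 := norm_slopeNormal_pos (F x)
  have hnorm : ‖slopeUnitNormal (F x)‖ = 1 := by
    rw [slopeUnitNormal, ← norm_slopeNormal, norm_smul, norm_inv, norm_norm]
    field_simp
  refine ⟨graphPoint_mem g x, hnorm, 1, one_pos, ?_⟩
  have h1 := isFoot_graphPoint hF hg x (ρ := (√(1 + F x ^ 2))⁻¹) (by positivity)
  have h2 := h1.infDist_eq
  rw [add_sub_cancel_left] at h2
  simp only [one_smul]
  exact h2.trans hnorm

lemma snd_eq_of_mem_unitNormalBundle {F g : ℝ → ℝ} (hF : Monotone F)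
    (hg : ∀ x, HasDerivAt g (F x) x) {z : WithLp 2 (Plane × Plane)}
    (hz : z ∈ unitNormalBundle (planeEpigraph g)) {x : ℝ} (hx : z.fst = graphPoint g x) :
    z.snd = slopeUnitNormal (F x) := by
  have hgc : Continuous g := continuous_iff_continuousAt.2 fun x => (hg x).continuousAt
  obtain ⟨hK, hu, s, hs, hd⟩ := hz
  obtain ⟨a, ha⟩ := exists_isFoot (isClosed_planeEpigraph hgc) (convex_planeEpigraph hF hg)
    ⟨_, graphPoint_mem g 0⟩ (z.fst + s • z.snd)
  have hmem : z.fst ∈ nearestPoints (planeEpigraph g) (z.fst + s • z.snd) := by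
    refine ⟨hK, ?_⟩
    rw [hd, add_sub_cancel_left, norm_smul, hu, Real.norm_of_nonneg hs.le, mul_one]
  rw [ha.nearestPoints_eq, mem_singleton_iff] at hmem
  have hnot : z.fst + s • z.snd ∉ planeEpigraph g := fun h => by
    rw [infDist_zero_of_mem h] at hd
    exact hs.ne hd
  obtain ⟨ρ, hρ, -, hy⟩ := ha.exists_eq_of_notMem hg hnot
  rw [← hmem, hx, graphPoint_zero] at hy
  have heq : s • z.snd = ρ • slopeNormal (F x) := add_left_cancel hy
  have hn := norm_slopeNormal_pos (F x)
  have hsρ : s = ρ * ‖slopeNormal (F x)‖ := by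
    have := congrArg norm heq
    rwa [norm_smul, norm_smul, hu, Real.norm_of_nonneg hs.le, Real.norm_of_nonneg hρ.le,
      mul_one] at this
  have : z.snd = s⁻¹ • ρ • slopeNormal (F x) := by
    rw [← heq, smul_smul, inv_mul_cancel₀ hs.ne', one_smul]
  rw [this, slopeUnitNormal, smul_smul, ← norm_slopeNormal, hsρ]
  congr 1
  field_simp

lemma unitNormalBundleOver_image_graphPoint {F g : ℝ → ℝ} (hF : Monotone F)
    (hg : ∀ x, HasDerivAt g (F x) x) (T : Set ℝ) :
    unitNormalBundleOver (planeEpigraph g) (graphPoint g '' T) =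
      (fun x => WithLp.toLp 2 (graphPoint g x, slopeUnitNormal (F x))) '' T := by
  ext z
  constructor
  · rintro ⟨hz, x, hx, hxz⟩
    refine ⟨x, hx, ?_⟩
    have := snd_eq_of_mem_unitNormalBundle hF hg hz hxz.symm
    simp only [hxz, ← this]
    rfl
  · rintro ⟨x, hx, rfl⟩
    exact ⟨toLp_graphPoint_slopeUnitNormal_mem hF hg x, x, hx, rfl⟩

/-- Countably many sets on which φ is Lipschitz cover the line, and on the line one-dimensional
Hausdorff measure is Lebesgue measure. -/
lemma LocallyLipschitz.hausdorffMeasure_one_image_eq_zero {X : Type*} [MetricSpace X]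
    [MeasurableSpace X] [BorelSpace X] {φ : ℝ → X} (hφ : LocallyLipschitz φ) {T : Set ℝ}
    (hT : volume T = 0) : Measure.hausdorffMeasure 1 (φ '' T) = 0 := by
  choose C t ht hC using hφ
  obtain ⟨s, hs, hcover⟩ := TopologicalSpace.countable_cover_nhds ht
  have hsub : φ '' T ⊆ ⋃ x ∈ s, φ '' (T ∩ t x) := by
    rintro _ ⟨y, hy, rfl⟩
    obtain ⟨x, hx, hyx⟩ := mem_iUnion₂.1 (hcover ▸ mem_univ y : y ∈ ⋃ x ∈ s, t x)
    exact mem_iUnion₂.2 ⟨x, hx, y, ⟨hy, hyx⟩, rfl⟩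
  refine measure_mono_null hsub ((measure_biUnion_null_iff hs).2 fun x _ => ?_)
  have h1 := ((hC x).mono (inter_subset_right (s := T))).hausdorffMeasure_image_le
    (d := 1) zero_le_one
  have h2 : Measure.hausdorffMeasure 1 (T ∩ t x) = 0 := by
    rw [hausdorffMeasure_real]
    exact measure_mono_null inter_subset_left hT
  rw [h2, mul_zero] at h1
  exact le_antisymm h1 zero_le

lemma locallyLipschitz_graphPoint {F g : ℝ → ℝ} (hF : Continuous F)
    (hg : ∀ x, HasDerivAt g (F x) x) : LocallyLipschitz (graphPoint g) := by
  have hg1 : ContDiff ℝ 1 g :=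
    contDiff_one_iff_deriv.2 ⟨fun x => (hg x).differentiableAt, by
      rwa [show deriv g = F from funext fun x => (hg x).deriv]⟩
  refine ContDiff.locallyLipschitz (𝕂 := ℝ) (contDiff_euclidean.2 fun i => ?_)
  fin_cases i
  · exact contDiff_id
  · exact hg1

lemma locallyLipschitz_slopeUnitNormal : LocallyLipschitz slopeUnitNormal := by
  refine ContDiff.locallyLipschitz (𝕂 := ℝ) (contDiff_one_iff_deriv.2
    ⟨fun m => (hasDerivAt_slopeUnitNormal m).differentiableAt, ?_⟩)
  rw [show deriv slopeUnitNormal = _ from funext fun m => (hasDerivAt_slopeUnitNormal m).deriv]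
  have h1 : Continuous fun m : ℝ => (√(1 + m ^ 2) ^ 3)⁻¹ := by
    refine Continuous.inv₀ (by fun_prop) fun m => ?_
    positivity
  have h2 : Continuous slopeTangent := by
    unfold slopeTangent
    fun_prop
  exact h1.smul h2

/-- Used with φ the first coordinate, which recovers T both from S and from the normal bundle over
S. -/
lemma hausdorffMeasure_eq_top_of_lipschitz_image {X : Type*} [MetricSpace X]
    [MeasurableSpace X] [BorelSpace X] {φ : X → ℝ} {C : NNReal} (hφ : LipschitzWith C φ)
    {S : Set X} {T : Set ℝ} (hT : 1 ≤ dimH T) (hST : T ⊆ φ '' S) {s : ℝ} (hs0 : 0 ≤ s)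
    (hs1 : s < 1) : Measure.hausdorffMeasure s S = ⊤ := by
  lift s to NNReal using hs0
  refine hausdorffMeasure_of_lt_dimH ?_
  calc (s : ENNReal) < 1 := by exact_mod_cast hs1
    _ ≤ dimH T := hT
    _ ≤ dimH (φ '' S) := dimH_mono hST
    _ ≤ dimH S := hφ.dimH_image_le S

lemma two_le_dimH_nonDirDiffPoints {F g : ℝ → ℝ} (hF : Monotone F) (hL : LipschitzWith 2 F)
    (hg : ∀ x, HasDerivAt g (F x) x) {A : Set ℝ}
    (hA : ∀ x ∈ A, ¬ DifferentiableWithinAt ℝ F (Ioi x) x) {f : ℝ → ℝ} {c e : NNReal}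
    (he0 : 0 < e) (he1 : e ≤ 1) (hf : HolderOnWith c e f A) (hfA : Icc 0 1 ⊆ f '' A) :
    2 ≤ dimH (nonDirDiffPoints (planeEpigraph g)) / e := by
  have hgc : Continuous g := continuous_iff_continuousAt.2 fun x => (hg x).continuousAt
  choose ξ hξ using exists_isFoot (isClosed_planeEpigraph hgc) (convex_planeEpigraph hF hg)
    ⟨_, graphPoint_mem g 0⟩
  have hξE : ∀ x ρ : ℝ, 0 < ρ → ξ (graphPoint g x + ρ • slopeNormal (F x)) = graphPoint g x :=
    fun x ρ hρ => (hξ _).unique (isFoot_graphPoint hF hg x hρ.le)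
  -- E is the union of the open normal half-lines over A; the abscissa of the foot and the distance
  -- to K serve as coordinates on it.
  obtain ⟨E, hE⟩ : ∃ E : Set Plane, ∀ y, y ∈ E ↔
      ∃ x ∈ A, ∃ ρ : ℝ, 0 < ρ ∧ y = graphPoint g x + ρ • slopeNormal (F x) :=
    ⟨{y | ∃ x ∈ A, ∃ ρ : ℝ, 0 < ρ ∧ y = graphPoint g x + ρ • slopeNormal (F x)}, fun _ => Iff.rfl⟩
  have hsub : E ⊆ nonDirDiffPoints (planeEpigraph g) := by
    intro y hy
    obtain ⟨x, hx, ρ, hρ, rfl⟩ := (hE y).1 hy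
    refine ⟨?_, not_multiDirDifferentiableAt_nearestPoints hF hL hg hρ (hA x hx)⟩
    simpa using add_smul_slopeNormal_notMem hF hg x 0 hρ
  have h1 : ∀ y ∈ E, ∀ z ∈ E, edist (ξ y 0) (ξ z 0) ≤ edist y z := by
    intro y _ z _
    rw [edist_dist, edist_dist]
    refine ENNReal.ofReal_le_ofReal ?_
    rw [Real.dist_eq, dist_eq_norm, ← Real.norm_eq_abs, ← PiLp.sub_apply]
    exact (PiLp.norm_apply_le _ 0).trans ((hξ y).norm_sub_le (hξ z))
  have h2 : ∀ y ∈ E, ξ y 0 ∈ A := by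
    intro y hy
    obtain ⟨x, hx, ρ, hρ, rfl⟩ := (hE y).1 hy
    rwa [hξE x ρ hρ, graphPoint_zero]
  have h3 : ∀ y ∈ E, ∀ z ∈ E,
      edist (infDist y (planeEpigraph g)) (infDist z (planeEpigraph g)) ≤ edist y z := by
    intro y _ z _
    have h := lipschitz_infDist_pt (planeEpigraph g) y z
    rwa [ENNReal.coe_one, one_mul] at h
  have h4 : ∀ x ∈ A, ∀ s ∈ Ioc (0 : ℝ) 1, ∃ y ∈ E, ξ y 0 = x ∧
      infDist y (planeEpigraph g) = s := by
    intro x hx s hs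
    have hn := norm_slopeNormal_pos (F x)
    have hρ : 0 < s / ‖slopeNormal (F x)‖ := div_pos hs.1 hn
    refine ⟨_, (hE _).2 ⟨x, hx, _, hρ, rfl⟩, by rw [hξE x _ hρ, graphPoint_zero], ?_⟩
    rw [(isFoot_graphPoint hF hg x hρ.le).infDist_eq, add_sub_cancel_left, norm_smul,
      Real.norm_of_nonneg hρ.le]
    field_simp
  have h5 := two_le_dimH_div (E := E) (ξ := fun y => ξ y 0)
    (δ := fun y => infDist y (planeEpigraph g)) he0 he1 hf h1 h2 h3 h4 hfA
  exact h5.trans (ENNReal.div_le_div_right (dimH_mono hsub) _)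

lemma compl_subset_closure_nonDirDiffPoints {F g : ℝ → ℝ} (hF : Monotone F)
    (hL : LipschitzWith 2 F) (hg : ∀ x, HasDerivAt g (F x) x) {T : Set ℝ} (hT : Dense T)
    (hTF : ∀ x ∈ T, ¬ DifferentiableWithinAt ℝ F (Ioi x) x) :
    (planeEpigraph g)ᶜ ⊆ closure (nonDirDiffPoints (planeEpigraph g)) := by
  have hgc : Continuous g := continuous_iff_continuousAt.2 fun x => (hg x).continuousAt
  intro y hy
  obtain ⟨a, ha⟩ := exists_isFoot (isClosed_planeEpigraph hgc) (convex_planeEpigraph hF hg)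
    ⟨_, graphPoint_mem g 0⟩ y
  obtain ⟨ρ, hρ, -, rfl⟩ := ha.exists_eq_of_notMem hg hy
  have hcont : Continuous fun x => graphPoint g x + ρ • slopeNormal (F x) := by
    have := hL.continuous
    unfold graphPoint slopeNormal
    fun_prop
  refine map_mem_closure (f := fun x => graphPoint g x + ρ • slopeNormal (F x)) hcont (hT (a 0))
    fun x hx => ?_
  refine ⟨?_, not_multiDirDifferentiableAt_nearestPoints hF hL hg hρ (hTF x hx)⟩
  simpa using add_smul_slopeNormal_notMem hF hg x 0 hρ

lemma dimH_eq_two_of_le {E : Set Plane} (h : 2 ≤ dimH E) : dimH E = 2 := by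
  refine le_antisymm ((dimH_mono (subset_univ E)).trans ?_) h
  rw [Real.dimH_univ_eq_finrank]
  simp

/-! ### Assembling the example -/

theorem mainTheorem4 :
    ∃ K S : Set Plane,
      IsClosed K ∧ Convex ℝ K ∧ HasC11Boundary K ∧
      S ⊆ frontier K ∧ frontier K ⊆ closure S ∧
      (Measure.hausdorffMeasure 1 S = 0 ∧
        ∀ s : ℝ, 0 ≤ s → s < 1 → Measure.hausdorffMeasure s S = ⊤) ∧
      (Measure.hausdorffMeasure 1 (unitNormalBundleOver K S) = 0 ∧
        ∀ s : ℝ, 0 ≤ s → s < 1 →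
          Measure.hausdorffMeasure s (unitNormalBundleOver K S) = ⊤) ∧
      (∀ r : ℝ, 0 < r → ∀ z ∈ unitNormalBundleOver K S,
        ¬ MultiDifferentiableAt (multiRestrict (nearestPoints K) (distLevel K r))
          (z.fst + r • z.snd)) ∧
      (Kᶜ ⊆ closure (Sigma2 K) ∧ dimH (Sigma2 K) = 2) ∧
      (Kᶜ ⊆ closure (nonDirDiffPoints K) ∧ dimH (nonDirDiffPoints K) = 2) := by
  obtain ⟨F, T, hF, hL, hT, hTF, hdim⟩ := exists_monotone_lipschitz_not_rightDifferentiable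
  set g : ℝ → ℝ := fun x => ∫ t in (0 : ℝ)..x, F t with hgdef
  have hg : ∀ x, HasDerivAt g (F x) x := fun x =>
    (hL.continuous.integral_hasStrictDerivAt 0 x).hasDerivAt
  have hgc : Continuous g := continuous_iff_continuousAt.2 fun x => (hg x).continuousAt
  have hcl := isClosed_planeEpigraph hgc
  have hconv := convex_planeEpigraph hF hg
  have hfr := frontier_planeEpigraph hgc
  -- Rademacher: a Lipschitz function is differentiable almost everywhere.
  have hTnull : volume T = 0 := by
    refine measure_mono_null (fun x hx => ?_) (ae_iff.1 hL.ae_differentiableAt_real)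
    exact fun h => hTF x hx h.differentiableWithinAt
  have hdimT : 1 ≤ dimH T := by
    have := ENNReal.natCast_le_of_forall_le_div (N := 1) (d := dimH T) fun r hr => by
      obtain ⟨A, f, c, e, hAT, hre, he0, he1, hf, hfA⟩ := hdim r hr
      refine ⟨e, hre, he0, ?_⟩
      calc ((1 : ℕ) : ENNReal) = dimH (Icc (0 : ℝ) 1) := by
            rw [Real.dimH_of_mem_nhds (Icc_mem_nhds (a := (0 : ℝ)) (x := 1 / 2) (b := 1)
              (by norm_num) (by norm_num))]
            simp
        _ ≤ dimH (f '' A) := dimH_mono hfA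
        _ ≤ dimH A / e := hf.dimH_image_le he0
        _ ≤ dimH T / e := by gcongr
    simpa using this
  have hdim2 : 2 ≤ dimH (nonDirDiffPoints (planeEpigraph g)) := by
    have := ENNReal.natCast_le_of_forall_le_div (N := 2)
      (d := dimH (nonDirDiffPoints (planeEpigraph g))) fun r hr => by
      obtain ⟨A, f, c, e, hAT, hre, he0, he1, hf, hfA⟩ := hdim r hr
      refine ⟨e, hre, he0, ?_⟩
      simpa using two_le_dimH_nonDirDiffPoints hF hL hg (fun x hx => hTF x (hAT hx)) he0 he1 hf hfA
    simpa using this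
  have hdense := compl_subset_closure_nonDirDiffPoints hF hL hg hT hTF
  have hsub : nonDirDiffPoints (planeEpigraph g) ⊆ Sigma2 (planeEpigraph g) := fun x hx =>
    ⟨hx.1, fun h =>
      hx.2 (h.multiDirDifferentiableAt_nearestPoints hcl hconv ⟨_, graphPoint_mem g 0⟩)⟩
  have hpl := locallyLipschitz_graphPoint hL.continuous hg
  refine ⟨planeEpigraph g, graphPoint g '' T, hcl, hconv, ?_, ?_, ?_, ⟨?_, ?_⟩, ⟨?_, ?_⟩, ?_,
    ⟨hdense.trans (closure_mono hsub), dimH_eq_two_of_le (hdim2.trans (dimH_mono hsub))⟩,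
    ⟨hdense, dimH_eq_two_of_le hdim2⟩⟩
  · intro p _
    refine ⟨LinearIsometryEquiv.refl ℝ Plane, g, ⟨fun x => (hg x).differentiableAt, 2, ?_⟩,
      Eventually.of_forall fun x => Iff.rfl⟩
    rwa [show deriv g = F from funext fun x => (hg x).deriv]
  · rw [hfr]; exact image_subset_range _ _
  · rw [hfr]
    rintro _ ⟨x, rfl⟩
    exact map_mem_closure hpl.continuous (hT x) fun y hy => mem_image_of_mem _ hy
  · exact hpl.hausdorffMeasure_one_image_eq_zero hTnull
  · intro s hs0 hs1
    refine hausdorffMeasure_eq_top_of_lipschitz_image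
      (EuclideanSpace.proj (𝕜 := ℝ) (0 : Fin 2) : Plane →L[ℝ] ℝ).lipschitz hdimT ?_ hs0 hs1
    intro x hx
    exact ⟨_, mem_image_of_mem _ hx, rfl⟩
  · rw [unitNormalBundleOver_image_graphPoint hF hg]
    refine LocallyLipschitz.hausdorffMeasure_one_image_eq_zero ?_ hTnull
    exact (WithLp.prodContinuousLinearEquiv 2 ℝ Plane Plane).symm.lipschitz.locallyLipschitz.comp
      (hpl.prodMk (locallyLipschitz_slopeUnitNormal.comp hL.locallyLipschitz))
  · intro s hs0 hs1
    rw [unitNormalBundleOver_image_graphPoint hF hg]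
    refine hausdorffMeasure_eq_top_of_lipschitz_image
      ((EuclideanSpace.proj (𝕜 := ℝ) (0 : Fin 2) : Plane →L[ℝ] ℝ).lipschitz.comp
        (LipschitzWith.prod_fst.comp
          (WithLp.prodContinuousLinearEquiv 2 ℝ Plane Plane).lipschitz)) hdimT ?_ hs0 hs1
    intro x hx
    exact ⟨_, mem_image_of_mem _ hx, rfl⟩
  · rintro r hr z ⟨hz, x, hx, hxz⟩
    rw [snd_eq_of_mem_unitNormalBundle hF hg hz hxz.symm, ← hxz]
    exact not_multiDifferentiableAt_distLevel hF hL hg hr (hTF x hx)
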